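/- \textbf{Theorem (Insertion Correctness).} \emph{NB-trees.} Fix integers $B,B'\ge 3$, $f\ge 3$ and $s\ge 2f$. An NB-tree is a tree (the s-tree) of \emph{s-nodes}, all leaves of which are on the same lowest level. Each s-node is a B$^+$-tree (its d-tree) of \emph{d-nodes}; a non-leaf d-node stores keys $K_1<\dots<K_n$ and $n+1$ pointers to d-nodes one level below, a leaf d-node stores a sorted list of key-value pairs. In a non-leaf s-node some of the stored keys are \emph{s-keys} and carry a pointer to a child s-node, and every leaf d-node carries one further pointer $P_{s\text{-}node}$ to a child s-node; all other keys are \emph{r-keys}. Leaf s-nodes store no pointers to s-nodes. The initial NB-tree is a single s-node with an empty d-tree (one empty leaf d-node). The keys of an s-node are those in its leaf d-nodes. \emph{Size requirements.} A leaf d-node has at most $B-1$ keys and, unless it is the root of its d-tree, at least $\lfloor\frac{B-1}2\rfloor$. A non-leaf d-node has at most $B'-1$ keys and, unless it is the root of its d-tree, at least $\lfloor\frac{B'-1}2\rfloor$. A non-leaf or root s-node has between $1$ and $s$ keys, any other (leaf) s-node between $\lfloor\frac s2\rfloor$ and $s$. \emph{Structural requirements.} $f\le \frac s2$; every non-leaf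 s-node has between $\lfloor\frac f2\rfloor$ and $f$ children and between $\lfloor\frac{f-1}2\rfloor$ and $f-1$ s-keys, where for the root the lower bounds are $2$ and $1$ instead. \emph{Properties.} (i) Every d-tree is a B$^+$-tree: its keys ascend from left to right, its leaf d-nodes are on one level, the keys below the $i$-th pointer of a non-leaf d-node are greater than $K_{i-1}$ and at most $K_i$, and a non-leaf root d-node has at least one key. (ii) All keys stored in the NB-tree are distinct, and distinct s-nodes have distinct addresses. (iii) Cross-s-node linkage: if $K_1<\dots<K_n$ are the s-keys of a non-leaf s-node, $K_0=-\infty$ and $K_{n+1}=+\infty$, then the s-node has exactly $n+1$ children $C_1,\dots,C_{n+1}$; $K_i$ points to $C_i$ for $1\le i\le n$; every key in $C_i$ or in an s-node below $C_i$ is greater than $K_{i-1}$ and at most $K_i$; and $P_{s\text{-}node}$ of a leaf d-node points to $C_i$, where $K_i$ is the first s-key found in the leaf d-nodes to the right of that d-node ($i=n+1$ if there is none). \emph{Insertion.} A new pair is inserted as an r-key into the root s-node. Every insertion into a d-tree is a B$^+$-tree insertion. An overfull leaf d-node is cut into its lower $\lfloor\cdot/2\rfloor$ and its upper half, the separator being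 the largest key of the lower half; an overfull non-leaf d-node is cut at its middle key, which moves up. When a leaf d-node is cut, the upper half keeps $P_{s\text{-}node}$ and the lower half gets the pointer of the smallest s-key in the upper half, or the same $P_{s\text{-}node}$ if there is none. (1) \emph{r-key into a leaf s-node}: if afterwards it has more than $s$ keys, it is split: the keys below the median form one s-node, the keys above it another, and the median is inserted as an s-key into the parent (Case 2); if the split s-node was the root, an empty non-leaf root s-node is first created as its parent. (2) \emph{s-key $K$ into a non-leaf s-node, after a child has been split into $C'$ (keys below $K$) and $C''$ (keys above $K$)}: $K$ gets a pointer to $C'$. With $K_s$ the largest s-key below $K$ and $K_l$ the smallest s-key above $K$ (or $\mp\infty$), $P_{s\text{-}node}$ is set to $C'$ in the leaf d-nodes whose largest key is in $[K_s,K)$ and to $C''$ in those whose largest key is in $[K,K_l)$. $C''$ keeps the address of the split child, $C'$ gets a new one. If afterwards there are more than $f-1$ s-keys, the s-node is split at its median s-key, together with its pointers, and that s-key is inserted as an s-key into the parent (created, as in (1), if it does not exist). (3) \emph{r-key into a non-leaf s-node}: if afterwards it has more than $s$ keys, it is merged down: all its r-keys are taken out, so that only its s-keys stay, and are then recursively inserted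 as r-keys one level below, in ascending order, each into the child whose key range contains it at that time (the smallest s-key above it, or the last $P_{s\text{-}node}$, leads to that child); every such insertion, with all splits and merges that it causes, is finished before the next begins. The d-trees of the s-nodes produced by splits and merges are built from the empty d-tree by inserting their keys in ascending order, r-keys as r-keys and s-keys as s-keys. \emph{Claim.} Let $T$ be the initial NB-tree, or an NB-tree that satisfies the size requirements, the structural requirements and the properties (i)--(iii). Let $(k,v)$ be a key-value pair whose key $k$ is not stored in $T$. Then the NB-tree obtained from $T$ by the insertion of $(k,v)$ satisfies the size requirements, the structural requirements and the properties (i)--(iii), and the pairs it stores are exactly those of $T$ together with $(k,v)$. -/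

import Mathlib

/-!  Nested B-trees (NB-trees).  Keys are ordered by a linear order on `K`; every key carries a value
in `V`.  Pointers to s-nodes are modelled by natural-number addresses; the sibling pointer of a leaf
d-node is the next leaf d-node in the left-to-right order.  All trees are indexed by their height
(height `0` = lowest level), since a pointer always leads exactly one level down. -/

namespace NBT

universe u v w

/-- `B`, `B'`: capacities of leaf and non-leaf d-nodes; `s`: size of an s-node; `f`: fanout. -/
structure Params where
  B : ℕ
  B' : ℕ
  s : ℕ
  f : ℕ

/-- A key-value pair in a leaf d-node.  It is an s-key iff it has an s-key pointer, else an r-key. -/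
structure Entry (K : Type u) (V : Type v) where
  key : K
  val : V
  ptr : Option ℕ

/-- A leaf d-node: a list of entries and the slot `P_{s-node}`. -/
structure LeafDNode (K : Type u) (V : Type v) where
  entries : List (Entry K V)
  pSnode : Option ℕ

/-- A non-leaf d-node: keys `K₁, …, Kₙ` and child d-nodes `P₁, …, Pₙ₊₁` (of type `C`). -/
structure InnerDNode (K : Type u) (C : Type w) where
  keys : List K
  kids : List C

/-- d-nodes with everything below them, by height. -/
@[reducible] def DNode (K : Type u) (V : Type v) : ℕ → Type (max u v)
  | 0 => LeafDNode K V
  | n + 1 => InnerDNode K (DNode K V n)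

/-- A data tree, given by its root d-node. -/
structure DTree (K : Type u) (V : Type v) where
  height : ℕ
  root : DNode K V height

/-- A leaf s-node: its address and its data tree. -/
structure LeafSNode (K : Type u) (V : Type v) where
  addr : ℕ
  dtree : DTree K V

/-- A non-leaf s-node: its address, its data tree and its child s-nodes (of type `C`). -/
structure InnerSNode (K : Type u) (V : Type v) (C : Type w) where
  addr : ℕ
  dtree : DTree K V
  kids : List C

/-- s-nodes with everything below them, by height. -/
@[reducible] def STree (K : Type u) (V : Type v) : ℕ → Type (max u v)
  | 0 => LeafSNode K V
  | n + 1 => InnerSNode K V (STree K V n)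

/-- An NB-tree, given by its root s-node. -/
structure NBTree (K : Type u) (V : Type v) where
  height : ℕ
  root : STree K V height

variable {K : Type u} {V : Type v}

/-! ### Contents -/

/-- The s-keys in a list of entries. -/
def sKeys (es : List (Entry K V)) : List (Entry K V) := es.filter fun e => e.ptr.isSome

/-- The r-keys in a list of entries. -/
def rKeys (es : List (Entry K V)) : List (Entry K V) := es.filter fun e => e.ptr.isNone

/-- The pointer of the first s-key of `es`, and `last` if there is none. -/
def nextPtr (es : List (Entry K V)) (last : Option ℕ) : Option ℕ :=
  match (sKeys es).head? with
  | some e => e.ptr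
  | none => last

/-- The leaf d-nodes (entries and `P_{s-node}`) from left to right. -/
def DNode.leaves : (n : ℕ) → DNode K V n → List (List (Entry K V) × Option ℕ)
  | 0, ⟨es, p⟩ => [(es, p)]
  | n + 1, ⟨_, cs⟩ => cs.flatMap fun c => DNode.leaves n c

/-- The entries in the leaf level below a d-node, from left to right. -/
def DNode.entries (n : ℕ) (t : DNode K V n) : List (Entry K V) :=
  (DNode.leaves n t).flatMap Prod.fst

def DTree.leaves (d : DTree K V) : List (List (Entry K V) × Option ℕ) := DNode.leaves d.height d.root

def DTree.entries (d : DTree K V) : List (Entry K V) := DNode.entries d.height d.root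

/-- The number of keys in the leaf level. -/
def DTree.size (d : DTree K V) : ℕ := d.entries.length

/-- `P_{s-node}` of the last leaf d-node. -/
def DTree.lastPtr (d : DTree K V) : Option ℕ :=
  match d.leaves.getLast? with
  | some l => l.2
  | none => none

/-- The address of an s-node. -/
def STree.addr : (n : ℕ) → STree K V n → ℕ
  | 0, ⟨a, _⟩ => a
  | _ + 1, ⟨a, _, _⟩ => a

/-- All entries stored in an s-node and in its descendants. -/
def STree.entries : (n : ℕ) → STree K V n → List (Entry K V)
  | 0, ⟨_, d⟩ => d.entries
  | n + 1, ⟨_, d, cs⟩ => d.entries ++ cs.flatMap fun c => STree.entries n c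

/-- The addresses of an s-node and of its descendants. -/
def STree.addrs : (n : ℕ) → STree K V n → List ℕ
  | 0, ⟨a, _⟩ => [a]
  | n + 1, ⟨a, _, cs⟩ => a :: cs.flatMap fun c => STree.addrs n c

def NBTree.entries (t : NBTree K V) : List (Entry K V) := STree.entries t.height t.root

def NBTree.keys (t : NBTree K V) : List K := t.entries.map Entry.key

/-- The stored key-value pairs. -/
def NBTree.pairs (t : NBTree K V) : List (K × V) := t.entries.map fun e => (e.key, e.val)

/-! ### Size requirements -/

/-- Size requirement for a non-root d-node and all d-nodes below it. -/
def DNode.SizeReq (p : Params) : (n : ℕ) → DNode K V n → Prop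
  | 0, ⟨es, _⟩ => (p.B - 1) / 2 ≤ es.length ∧ es.length ≤ p.B - 1
  | n + 1, ⟨ks, cs⟩ => (p.B' - 1) / 2 ≤ ks.length ∧ ks.length ≤ p.B' - 1 ∧
      ∀ c ∈ cs, DNode.SizeReq p n c

/-- d-node size requirements for a whole d-tree; the root d-node has no lower bound. -/
def DTree.SizeReq (p : Params) : DTree K V → Prop
  | ⟨0, ⟨es, _⟩⟩ => es.length ≤ p.B - 1
  | ⟨n + 1, ⟨ks, cs⟩⟩ => ks.length ≤ p.B' - 1 ∧ ∀ c ∈ cs, DNode.SizeReq p n c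

/-- Size requirements for all d-nodes and s-nodes; `isRoot` tells whether the top s-node is the root. -/
def STree.SizeReq (p : Params) : (n : ℕ) → (isRoot : Bool) → STree K V n → Prop
  | 0, isRoot, ⟨_, d⟩ => d.SizeReq p ∧ (if isRoot then 1 else p.s / 2) ≤ d.size ∧ d.size ≤ p.s
  | n + 1, _, ⟨_, d, cs⟩ => d.SizeReq p ∧ 1 ≤ d.size ∧ d.size ≤ p.s ∧
      ∀ c ∈ cs, STree.SizeReq p n false c

def NBTree.SizeRequirements (p : Params) (t : NBTree K V) : Prop :=
  STree.SizeReq p t.height true t.root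

/-! ### Structural requirements -/

/-- Bounds on the numbers of children and of s-keys of all non-leaf s-nodes. -/
def STree.StructReq (p : Params) : (n : ℕ) → (isRoot : Bool) → STree K V n → Prop
  | 0, _, _ => True
  | n + 1, isRoot, ⟨_, d, cs⟩ =>
      (if isRoot then 2 else p.f / 2) ≤ cs.length ∧ cs.length ≤ p.f ∧
      (if isRoot then 1 else (p.f - 1) / 2) ≤ (sKeys d.entries).length ∧
      (sKeys d.entries).length ≤ p.f - 1 ∧
      ∀ c ∈ cs, STree.StructReq p n false c

/-- The structural requirements, including the bound on the fanout. -/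
def NBTree.StructuralRequirements (p : Params) (t : NBTree K V) : Prop :=
  2 * p.f ≤ p.s ∧ STree.StructReq p t.height true t.root

/-! ### B⁺-tree property of the d-trees -/

section order

variable [LinearOrder K]

/-- The search-tree property below a d-node: keys are strictly increasing, a non-leaf d-node has one
child more than keys, and the keys below its `i`-th child are greater than its `(i-1)`-st key and at
most its `i`-th key. -/
def DNode.IsBPlus : (n : ℕ) → DNode K V n → Prop
  | 0, ⟨es, _⟩ => (es.map Entry.key).Pairwise (· < ·)
  | n + 1, ⟨ks, cs⟩ => ks.Pairwise (· < ·) ∧ cs.length = ks.length + 1 ∧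
      (∀ (i : ℕ) (k : K) (c : DNode K V n), ks[i]? = some k → cs[i]? = some c →
        ∀ e ∈ DNode.entries n c, e.key ≤ k) ∧
      (∀ (i : ℕ) (k : K) (c : DNode K V n), ks[i]? = some k → cs[i + 1]? = some c →
        ∀ e ∈ DNode.entries n c, k < e.key) ∧
      ∀ c ∈ cs, DNode.IsBPlus n c

/-- A d-tree is a B⁺-tree; a non-leaf root d-node has at least one key. -/
def DTree.IsBPlus : DTree K V → Prop
  | ⟨0, t⟩ => DNode.IsBPlus 0 t
  | ⟨n + 1, ⟨ks, cs⟩⟩ => ks ≠ [] ∧ DNode.IsBPlus (n + 1) ⟨ks, cs⟩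

def STree.AllBPlus : (n : ℕ) → STree K V n → Prop
  | 0, ⟨_, d⟩ => d.IsBPlus
  | n + 1, ⟨_, d, cs⟩ => d.IsBPlus ∧ ∀ c ∈ cs, STree.AllBPlus n c

/-! ### Pointers and the cross-s-node linkage property -/

/-- A d-tree in a leaf s-node stores no pointers to s-nodes. -/
def NoPointers (d : DTree K V) : Prop :=
  (∀ e ∈ d.entries, e.ptr = none) ∧ ∀ l ∈ d.leaves, l.2 = none

/-- Linkage between a non-leaf s-node with d-tree `d` and its child s-nodes `cs`.  With s-keys
`K₁ < … < Kₙ` (and `K₀ = -∞`, `Kₙ₊₁ = +∞`):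
* there are `n + 1` children, and the pointer of `Kᵢ` is the address of the `i`-th one;
* all keys in the `i`-th child, and in the s-nodes below it, are `> Kᵢ₋₁` and `≤ Kᵢ`;
* `P_{s-node}` of a leaf d-node equals the pointer of the first s-key found in the following leaf
  d-nodes, and leads to the last child if there is none. -/
def Linked {n : ℕ} (d : DTree K V) (cs : List (STree K V n)) : Prop :=
  let sk := sKeys d.entries
  let last : Option ℕ := cs.getLast?.map (STree.addr n)
  sk.map Entry.ptr ++ [last] = cs.map (fun c => some (STree.addr n c)) ∧
  (∀ (i : ℕ) (e : Entry K V) (c : STree K V n), sk[i]? = some e → cs[i]? = some c →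
    ∀ x ∈ STree.entries n c, x.key ≤ e.key) ∧
  (∀ (i : ℕ) (e : Entry K V) (c : STree K V n), sk[i]? = some e → cs[i + 1]? = some c →
    ∀ x ∈ STree.entries n c, e.key < x.key) ∧
  ∀ (j : ℕ) (l : List (Entry K V) × Option ℕ), d.leaves[j]? = some l →
    l.2 = nextPtr ((d.leaves.drop (j + 1)).flatMap Prod.fst) last

def STree.CrossLinked : (n : ℕ) → STree K V n → Prop
  | 0, ⟨_, d⟩ => NoPointers d
  | n + 1, ⟨_, d, cs⟩ => Linked d cs ∧ ∀ c ∈ cs, STree.CrossLinked n c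

/-- Every d-tree is a B⁺-tree, keys are distinct, s-nodes have distinct addresses, and the
cross-s-node linkage property holds at every s-node. -/
def NBTree.Properties (t : NBTree K V) : Prop :=
  STree.AllBPlus t.height t.root ∧ t.keys.Nodup ∧ (STree.addrs t.height t.root).Nodup ∧
  STree.CrossLinked t.height t.root

/-! ### Insertion into a d-tree -/

/-- Insertion of an entry into a list that is sorted by keys. -/
def insertSorted (e : Entry K V) : List (Entry K V) → List (Entry K V)
  | [] => [e]
  | x :: xs => if e.key < x.key then e :: x :: xs else x :: insertSorted e xs

/-- Outcome of an insertion below a d-node: one d-node, or two d-nodes with a separating key. -/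
inductive DRes (K : Type u) (V : Type v) (n : ℕ) : Type (max u v)
  | one (t : DNode K V n) : DRes K V n
  | two (l : DNode K V n) (k : K) (r : DNode K V n) : DRes K V n

/-- B⁺-tree insertion.  When a leaf d-node is split, the upper half keeps `P_{s-node}`, and the lower
half gets the pointer of the smallest s-key of the upper half, or the same pointer if there is none. -/
def DNode.insert (p : Params) (e : Entry K V) : (n : ℕ) → DNode K V n → DRes K V n
  | 0, ⟨es, q⟩ =>
      let es₁ := insertSorted e es
      if es₁.length ≤ p.B - 1 then .one ⟨es₁, q⟩
      else
        let lo := es₁.take (es₁.length / 2)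
        let hi := es₁.drop (es₁.length / 2)
        match lo.getLast? with
        | some x => .two ⟨lo, nextPtr hi q⟩ x.key ⟨hi, q⟩
        | none => .one ⟨es₁, q⟩
  | n + 1, ⟨ks, cs⟩ =>
      let i := (ks.takeWhile fun k => k < e.key).length
      match cs[i]? with
      | none => .one ⟨ks, cs⟩
      | some c =>
        match DNode.insert p e n c with
        | .one c₁ => .one ⟨ks, cs.set i c₁⟩
        | .two l k r =>
          let ks₁ := ks.take i ++ k :: ks.drop i
          let cs₁ := cs.take i ++ l :: r :: cs.drop (i + 1)
          if ks₁.length ≤ p.B' - 1 then .one ⟨ks₁, cs₁⟩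
          else
            let m := ks₁.length / 2
            match ks₁[m]? with
            | some x => .two ⟨ks₁.take m, cs₁.take (m + 1)⟩ x
                ⟨ks₁.drop (m + 1), cs₁.drop (m + 1)⟩
            | none => .one ⟨ks₁, cs₁⟩

/-- The empty d-tree, with the given `P_{s-node}`. -/
def DTree.empty (q : Option ℕ) : DTree K V := ⟨0, ⟨[], q⟩⟩

/-- B⁺-tree insertion at the root; a root split adds a level. -/
def DTree.insert (p : Params) (e : Entry K V) (d : DTree K V) : DTree K V :=
  match DNode.insert p e d.height d.root with
  | .one t => ⟨d.height, t⟩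
  | .two l k r => ⟨d.height + 1, ⟨[k], [l, r]⟩⟩

/-- Replace `P_{s-node}` in every leaf d-node. -/
def DNode.mapPtr (g : List (Entry K V) → Option ℕ → Option ℕ) : (n : ℕ) → DNode K V n → DNode K V n
  | 0, ⟨es, q⟩ => ⟨es, g es q⟩
  | n + 1, ⟨ks, cs⟩ => ⟨ks, cs.map fun c => DNode.mapPtr g n c⟩

/-- Insertion of the s-key `e` into the d-tree of a non-leaf s-node.  The pointer of `e` leads to the
lower piece of a split child, `hiPtr` to the upper piece.  Let `Kₛ` be the largest s-key below `e` and
`Kₗ` the smallest s-key above `e`.  Leaf d-nodes with largest key in `[Kₛ, e)` get the pointer to the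
lower piece, those with largest key in `[e, Kₗ)` the pointer to the upper piece. -/
def DTree.insertS (p : Params) (e : Entry K V) (hiPtr : Option ℕ) (d : DTree K V) : DTree K V :=
  let sk := sKeys d.entries
  let kS : Option K := ((sk.filter fun x => x.key < e.key).getLast?).map Entry.key
  let kL : Option K := ((sk.filter fun x => e.key < x.key).head?).map Entry.key
  let d₁ := d.insert p e
  let g : List (Entry K V) → Option ℕ → Option ℕ := fun es q =>
    match es.getLast? with
    | none => q
    | some x =>
      if x.key < e.key then
        match kS with
        | none => e.ptr
        | some k => if k ≤ x.key then e.ptr else q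
      else
        match kL with
        | none => hiPtr
        | some k => if x.key < k then hiPtr else q
  ⟨d₁.height, DNode.mapPtr g d₁.height d₁.root⟩

/-- Insert the entries one after the other, r-keys as r-keys and s-keys as s-keys.  To the right of
the last s-key the pointer is `last`. -/
def DTree.insertAll (p : Params) (last : Option ℕ) : List (Entry K V) → DTree K V → DTree K V
  | [], d => d
  | e :: es, d =>
      DTree.insertAll p last es
        (if e.ptr.isSome then d.insertS p e (nextPtr es last) else d.insert p e)

/-- The d-tree of a new s-node, obtained from the empty one by inserting the entries. -/
def DTree.build (p : Params) (last : Option ℕ) (es : List (Entry K V)) : DTree K V :=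
  DTree.insertAll p last es (DTree.empty (nextPtr es last))

/-! ### Insertion into an NB-tree -/

/-- Outcome of an insertion below an s-node: one s-node, or two s-nodes with the promoted median. -/
inductive SRes (K : Type u) (V : Type v) (n : ℕ) : Type (max u v)
  | one (t : STree K V n) : SRes K V n
  | two (l : STree K V n) (k : K) (x : V) (r : STree K V n) : SRes K V n

/-- Pointer to the child for the key `k`: that of the smallest s-key greater than `k`, and
`P_{s-node}` of the last leaf d-node if there is no such s-key. -/
def DTree.route (d : DTree K V) (k : K) : Option ℕ :=
  nextPtr ((sKeys d.entries).filter fun e => k < e.key) d.lastPtr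

/-- Split of a leaf s-node.  The upper piece keeps the address, the lower one gets address `a`. -/
def splitLeaf (p : Params) (a addr : ℕ) (d : DTree K V) : SRes K V 0 :=
  let es := d.entries
  let m := es.length / 2
  match es[m]? with
  | some x => .two ⟨a, DTree.build p none (es.take m)⟩ x.key x.val
      ⟨addr, DTree.build p none (es.drop (m + 1))⟩
  | none => .one ⟨addr, d⟩

/-- Split of a non-leaf s-node at the median of its s-keys. -/
def splitNode (p : Params) (a addr : ℕ) {n : ℕ} (d : DTree K V) (cs : List (STree K V n)) :
    SRes K V (n + 1) :=
  let es := d.entries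
  let m := (sKeys es).length / 2
  match (sKeys es)[m]? with
  | some x =>
      .two ⟨a, DTree.build p x.ptr (es.filter fun e => e.key < x.key), cs.take (m + 1)⟩
        x.key x.val
        ⟨addr, DTree.build p d.lastPtr (es.filter fun e => x.key < e.key), cs.drop (m + 1)⟩
  | none => .one ⟨addr, d, cs⟩

/-- Insertion of `e` as an r-key into the s-node at height `h` on the search path of `e`.
* A leaf s-node that becomes oversize is split, and its median is inserted as an s-key into the parent.
* A non-leaf s-node that becomes oversize is merged down: only its s-keys stay, and its r-keys are
  returned in the second component, to be inserted one level below.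
* A non-leaf s-node that gets more than `f - 1` s-keys is split, and the median s-key is inserted as
  an s-key into the parent.
Unused addresses are `a, a + 1, …`; a split at height `n` uses `a + n`. -/
def STree.insertAt (p : Params) (a h : ℕ) (e : Entry K V) :
    (n : ℕ) → STree K V n → SRes K V n × List (Entry K V)
  | 0, ⟨addr, d⟩ =>
      let d₁ := d.insert p e
      if d₁.size ≤ p.s then (.one ⟨addr, d₁⟩, []) else (splitLeaf p a addr d₁, [])
  | n + 1, ⟨addr, d, cs⟩ =>
      if h = n + 1 then
        let d₁ := d.insert p e
        if d₁.size ≤ p.s then (.one ⟨addr, d₁, cs⟩, [])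
        else (.one ⟨addr, DTree.build p d₁.lastPtr (sKeys d₁.entries), cs⟩, rKeys d₁.entries)
      else
        let i := cs.findIdx fun c => d.route e.key = some (STree.addr n c)
        match cs[i]? with
        | none => (.one ⟨addr, d, cs⟩, [])
        | some c =>
          match STree.insertAt p a h e n c with
          | (.one c₁, flushed) => (.one ⟨addr, d, cs.set i c₁⟩, flushed)
          | (.two l k x r, flushed) =>
            let d₁ := d.insertS p ⟨k, x, some (STree.addr n l)⟩ (some (STree.addr n r))
            let cs₁ := cs.take i ++ l :: r :: cs.drop (i + 1)
            if (sKeys d₁.entries).length ≤ p.f - 1 then (.one ⟨addr, d₁, cs₁⟩, flushed)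
            else (splitNode p (a + (n + 1)) addr d₁ cs₁, flushed)

/-- The same for an NB-tree; when the root s-node is split, a new root s-node is created. -/
def NBTree.insertAt (p : Params) (h : ℕ) (e : Entry K V) (t : NBTree K V) :
    NBTree K V × List (Entry K V) :=
  let a := (STree.addrs t.height t.root).foldr max 0 + 1
  match STree.insertAt p a h e t.height t.root with
  | (.one r, flushed) => (⟨t.height, r⟩, flushed)
  | (.two l k x r, flushed) =>
      (⟨t.height + 1, ⟨a + t.height + 1, (DTree.empty none).insertS p ⟨k, x, some (STree.addr t.height l)⟩
          (some (STree.addr t.height r)), [l, r]⟩⟩, flushed)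

/-- Recursive insertion of `e` as an r-key at height `h`.  If the s-node is merged down, its r-keys
are recursively inserted one level below, in ascending order, each insertion being finished (with all
splits and merges that it causes) before the next one starts. -/
def NBTree.insertRec (p : Params) : ℕ → Entry K V → NBTree K V → NBTree K V
  | 0, e, t => (t.insertAt p 0 e).1
  | h + 1, e, t =>
      let r := t.insertAt p (h + 1) e
      r.2.foldl (fun t₁ e₁ => NBTree.insertRec p h e₁ t₁) r.1

/-- Insertion of a key-value pair: it is inserted as an r-key into the root s-node. -/
def NBTree.insert (p : Params) (k : K) (x : V) (t : NBTree K V) : NBTree K V :=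
  NBTree.insertRec p t.height ⟨k, x, none⟩ t

end order

/-- The initial NB-tree: one s-node, whose d-tree is empty. -/
def NBTree.initial (a : ℕ) : NBTree K V := ⟨0, ⟨a, DTree.empty none⟩⟩

end NBT

/-!
Every invariant is made recursive, so that an insertion can be analysed one node at a time: a d-node
or s-node is well formed if its keys separate its children and its children are well formed, and
within a well-formed s-node the slot `P_{s-node}` of a leaf d-node holds the pointer of the next
s-key to the right.  An insertion below a node either replaces the node or splits it in two, the
larger keys of the right half being above a separator, and in both cases the parent only has to
exchange the child that lies on the search path.

A merge is finished before the next r-key is inserted, and the s-nodes above the merged one then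
hold only s-keys: each of them was itself merged down, was split off from such an s-node, or is a
new root.  For these s-nodes the bound `f - 1` on the s-keys is also a bound on all keys, so that
`f ≤ s` leaves room for one more s-key.  That the s-nodes on the search path stay free of r-keys is
therefore part of the induction hypothesis.
-/

namespace NBT

universe u v w

variable {K : Type u} {V : Type v}

theorem exists_eq_append_cons_of_lt {α : Type*} {l : List α} {i : ℕ} (h : i < l.length) :
    ∃ as x bs, l = as ++ x :: bs ∧ as.length = i :=
  ⟨l.take i, l[i], l.drop (i + 1), by simp, by simpa using h.le⟩

/-! ### Pointers to the next s-key -/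

/-- The contents of consecutive leaf d-nodes, in the form returned by `DNode.leaves`. -/
abbrev LeafList (K : Type u) (V : Type v) := List (List (Entry K V) × Option ℕ)

@[simp] theorem nextPtr_nil (q : Option ℕ) : nextPtr ([] : List (Entry K V)) q = q := rfl

@[simp] theorem nextPtr_cons (e : Entry K V) (es : List (Entry K V)) (q : Option ℕ) :
    nextPtr (e :: es) q = e.ptr.or (nextPtr es q) := by
  unfold nextPtr sKeys
  cases h : e.ptr <;> simp [h]

@[simp] theorem nextPtr_append (as bs : List (Entry K V)) (q : Option ℕ) :
    nextPtr (as ++ bs) q = nextPtr as (nextPtr bs q) := by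
  induction as with
  | nil => rfl
  | cons e es ih => simp [ih]

theorem nextPtr_of_forall_none {es : List (Entry K V)} (h : ∀ e ∈ es, e.ptr = none)
    (q : Option ℕ) : nextPtr es q = q := by
  induction es with
  | nil => rfl
  | cons e es ih =>
    simp only [List.forall_mem_cons] at h
    simp [h.1, ih h.2]

theorem nextPtr_congr_of_exists_isSome {es : List (Entry K V)} (h : ∃ e ∈ es, e.ptr.isSome)
    (q q' : Option ℕ) : nextPtr es q = nextPtr es q' := by
  obtain ⟨e, he, hs⟩ := h
  obtain ⟨as, bs, rfl⟩ := List.append_of_mem he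
  obtain ⟨a, ha⟩ := Option.isSome_iff_exists.1 hs
  simp [ha]

theorem head?_map_ptr_append {es : List (Entry K V)} (h : ∀ e ∈ es, e.ptr.isSome)
    (q : Option ℕ) : (es.map Entry.ptr ++ [q]).head? = some (nextPtr es q) := by
  cases es with
  | nil => rfl
  | cons e es =>
    obtain ⟨a, ha⟩ := Option.isSome_iff_exists.1 (h e (by simp))
    simp [ha]

theorem sKeys_eq_self {es : List (Entry K V)} (h : ∀ e ∈ es, e.ptr.isSome) : sKeys es = es := by
  simpa [sKeys, List.filter_eq_self] using h

@[simp] theorem mem_sKeys {e : Entry K V} {es : List (Entry K V)} :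
    e ∈ sKeys es ↔ e ∈ es ∧ e.ptr.isSome := List.mem_filter

@[simp] theorem sKeys_append (as bs : List (Entry K V)) :
    sKeys (as ++ bs) = sKeys as ++ sKeys bs := List.filter_append ..

theorem sKeys_append_rKeys_perm (es : List (Entry K V)) : (sKeys es ++ rKeys es).Perm es := by
  simpa [sKeys, rKeys] using List.filter_append_perm (fun e : Entry K V => e.ptr.isSome) es

/-- `P_{s-node}` of every leaf d-node is the pointer of the next s-key to the right of the leaf, and
`last` if there is none.  This is the recursive form of the last clause of `Linked`. -/
def Threaded (last : Option ℕ) : LeafList K V → Prop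
  | [] => True
  | l :: ls => l.2 = nextPtr (ls.flatMap Prod.fst) last ∧ Threaded last ls

theorem threaded_iff_getElem? {last : Option ℕ} {ls : LeafList K V} :
    Threaded last ls ↔ ∀ (j : ℕ) (l : List (Entry K V) × Option ℕ), ls[j]? = some l →
      l.2 = nextPtr ((ls.drop (j + 1)).flatMap Prod.fst) last := by
  induction ls with
  | nil => simp [Threaded]
  | cons a ls ih =>
    rw [Threaded, ih]
    conv_rhs => rw [← Nat.and_forall_add_one]
    simp

theorem threaded_append {last : Option ℕ} {as bs : LeafList K V} :
    Threaded last (as ++ bs) ↔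
      Threaded (nextPtr (bs.flatMap Prod.fst) last) as ∧ Threaded last bs := by
  induction as with
  | nil => simp [Threaded]
  | cons a as ih => simp [Threaded, ih, and_assoc]

section order

variable [LinearOrder K]

/-! ### Sorted lists of entries -/

/-- Entries in strictly ascending order of their keys. -/
def Ascending (es : List (Entry K V)) : Prop := es.Pairwise fun a b => a.key < b.key

theorem ascending_iff_pairwise_map {es : List (Entry K V)} :
    Ascending es ↔ (es.map Entry.key).Pairwise (· < ·) := by
  rw [Ascending, List.pairwise_map]

theorem ascending_append {as bs : List (Entry K V)} :
    Ascending (as ++ bs) ↔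
      Ascending as ∧ Ascending bs ∧ ∀ a ∈ as, ∀ b ∈ bs, a.key < b.key :=
  List.pairwise_append

theorem Ascending.le_of_mem_concat {es : List (Entry K V)} {x : Entry K V}
    (h : Ascending (es ++ [x])) : ∀ a ∈ es ++ [x], a.key ≤ x.key := by
  rw [List.forall_mem_append]
  exact ⟨fun a ha => ((ascending_append.1 h).2.2 a ha x (by simp)).le, by simp⟩

theorem insertSorted_append {e : Entry K V} {as bs : List (Entry K V)}
    (has : ∀ x ∈ as, x.key < e.key) (hbs : ∀ x ∈ bs, e.key < x.key) :
    insertSorted e (as ++ bs) = as ++ e :: bs := by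
  induction as with
  | nil => cases bs <;> simp_all [insertSorted]
  | cons a as ih =>
    simp only [List.forall_mem_cons] at has
    simp [insertSorted, has.1.le, ih has.2]

theorem Ascending.exists_cut {es : List (Entry K V)} (h : Ascending es) {y : K}
    (hy : ∀ x ∈ es, x.key ≠ y) :
    ∃ as bs, es = as ++ bs ∧ (∀ x ∈ as, x.key < y) ∧ ∀ x ∈ bs, y < x.key := by
  induction es with
  | nil => exact ⟨[], [], rfl, by simp, by simp⟩
  | cons a es ih =>
    simp only [List.forall_mem_cons] at hy
    obtain ⟨ha, hes⟩ := List.pairwise_cons.1 h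
    rcases lt_or_gt_of_ne hy.1 with hay | hay
    · obtain ⟨as, bs, rfl, has, hbs⟩ := ih hes hy.2
      exact ⟨a :: as, bs, rfl, by simpa [hay] using has, hbs⟩
    · exact ⟨[], a :: es, rfl, by simp, by simpa [hay] using fun x hx => hay.trans (ha x hx)⟩

theorem insertSorted_perm (e : Entry K V) (es : List (Entry K V)) :
    (insertSorted e es).Perm (e :: es) := by
  induction es with
  | nil => exact .refl _
  | cons a es ih =>
    rw [insertSorted]
    split
    · exact .refl _
    · exact (ih.cons a).trans (.swap _ _ _)

@[simp] theorem length_insertSorted (e : Entry K V) (es : List (Entry K V)) :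
    (insertSorted e es).length = es.length + 1 := (insertSorted_perm e es).length_eq

@[simp] theorem mem_insertSorted {e x : Entry K V} {es : List (Entry K V)} :
    x ∈ insertSorted e es ↔ x = e ∨ x ∈ es := by
  simp [(insertSorted_perm e es).mem_iff]

theorem Ascending.insertSorted {e : Entry K V} {es : List (Entry K V)} (h : Ascending es)
    (he : ∀ x ∈ es, x.key ≠ e.key) : Ascending (insertSorted e es) := by
  obtain ⟨as, bs, rfl, has, hbs⟩ := h.exists_cut he
  rw [insertSorted_append has hbs]
  unfold Ascending at *
  grind [List.pairwise_cons]

theorem nextPtr_insertSorted {e : Entry K V} (he : e.ptr = none) (es : List (Entry K V))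
    (q : Option ℕ) : nextPtr (insertSorted e es) q = nextPtr es q := by
  induction es with
  | nil => simp [insertSorted, he]
  | cons a es ih =>
    rw [insertSorted]
    split <;> simp [he, ih]

theorem sKeys_insertSorted {e : Entry K V} (he : e.ptr = none) (es : List (Entry K V)) :
    sKeys (insertSorted e es) = sKeys es := by
  induction es with
  | nil => simp [insertSorted, sKeys, he]
  | cons a es ih =>
    unfold sKeys at *
    rw [insertSorted]
    split <;> simp [he, List.filter_cons, ih]

theorem Ascending.filter_key_lt {as bs : List (Entry K V)} {x : Entry K V}
    (h : Ascending (as ++ x :: bs)) : (as ++ x :: bs).filter (fun e => e.key < x.key) = as := by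
  simp only [Ascending, List.pairwise_append, List.pairwise_cons, List.mem_cons] at h
  grind [List.filter_eq_self, List.filter_eq_nil_iff]

theorem Ascending.filter_lt_key {as bs : List (Entry K V)} {x : Entry K V}
    (h : Ascending (as ++ x :: bs)) : (as ++ x :: bs).filter (fun e => x.key < e.key) = bs := by
  simp only [Ascending, List.pairwise_append, List.pairwise_cons, List.mem_cons] at h
  grind [List.filter_eq_self, List.filter_eq_nil_iff]

end order

/-! ### Separators -/

section separators

variable {α : Type w} [LinearOrder K] {S : α → Set K} {ks kl kr : List K}
  {cs cl cr : List α} {c c' l r : α} {k x y : K}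

/-- `ks` separates the objects `cs`, where `c` holds the set `S c` of keys: the `i`-th separator is
at least every key of the `i`-th object, and less than all later separators and all keys of later
objects.  There may be more objects than separators; what follows the last separator is bounded
only from below. -/
def Separates (S : α → Set K) : List K → List α → Prop
  | [], _ => True
  | _ :: _, [] => False
  | k :: ks, c :: cs => (∀ x ∈ S c, x ≤ k) ∧ (∀ k' ∈ ks, k < k') ∧
      (∀ c' ∈ cs, ∀ x ∈ S c', k < x) ∧ Separates S ks cs

theorem separates_append (hl : kl.length = cl.length) :
    Separates S (kl ++ kr) (cl ++ cr) ↔ Separates S kl cl ∧ Separates S kr cr ∧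
      ∀ k ∈ kl, (∀ k' ∈ kr, k < k') ∧ ∀ c ∈ cr, ∀ x ∈ S c, k < x := by
  induction kl generalizing cl with
  | nil =>
    obtain rfl : cl = [] := List.length_eq_zero_iff.1 hl.symm
    simp [Separates]
  | cons k kl ih =>
    cases cl with
    | nil => simp at hl
    | cons c cl =>
      simp only [List.cons_append, Separates, ih (Nat.succ.inj hl), List.mem_append,
        List.mem_cons, or_imp, forall_and, forall_eq]
      tauto

theorem separates_map {β : Type*} {g : α → β} {S' : β → Set K} (h : ∀ c, S' (g c) = S c) :
    Separates S' ks (cs.map g) ↔ Separates S ks cs := by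
  induction ks generalizing cs with
  | nil => simp [Separates]
  | cons k ks ih => cases cs <;> simp [Separates, h, ih]

theorem Separates.pairwise (h : Separates S ks cs) : ks.Pairwise (· < ·) := by
  induction ks generalizing cs with
  | nil => exact .nil
  | cons k ks ih =>
    cases cs with
    | nil => exact h.elim
    | cons c cs => exact .cons h.2.1 (ih h.2.2.2)

theorem Separates.exists_forall_le (h : Separates S ks cs) (hl : ks.length = cs.length)
    (hc : c ∈ cs) : ∃ k ∈ ks, ∀ x ∈ S c, x ≤ k := by
  induction ks generalizing cs with
  | nil => simp [List.length_eq_zero_iff.1 hl.symm] at hc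
  | cons k ks ih =>
    cases cs with
    | nil => exact h.elim
    | cons c₀ cs =>
      rcases List.mem_cons.1 hc with rfl | hc
      · exact ⟨k, by simp, h.1⟩
      · obtain ⟨k', hk', hle⟩ := ih h.2.2.2 (Nat.succ.inj hl) hc
        exact ⟨k', by simp [hk'], hle⟩

theorem separates_iff_getElem? (hl : cs.length = ks.length + 1) :
    Separates S ks cs ↔ ks.Pairwise (· < ·) ∧
      (∀ (i : ℕ) (k : K) (c : α), ks[i]? = some k → cs[i]? = some c → ∀ x ∈ S c, x ≤ k) ∧
      (∀ (i : ℕ) (k : K) (c : α), ks[i]? = some k → cs[i + 1]? = some c →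
        ∀ x ∈ S c, k < x) := by
  induction ks generalizing cs with
  | nil => simp [Separates]
  | cons k ks ih =>
    cases cs with
    | nil => simp at hl
    | cons c cs =>
      have hl' : cs.length = ks.length + 1 := Nat.succ.inj hl
      obtain ⟨c₁, cs₁, rfl⟩ := List.exists_cons_of_length_eq_add_one hl'
      rw [Separates, ih hl', List.pairwise_cons]
      constructor
      · rintro ⟨hc, hks, hcs, hpw, hle, hlt⟩
        refine ⟨⟨hks, hpw⟩, ?_, ?_⟩ <;> rintro (_ | i) k' c' hk hc'
        · simp_all
        · exact hle i k' c' hk hc'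
        · simp_all
        · exact hlt i k' c' hk hc'
      · rintro ⟨⟨hks, hpw⟩, hle, hlt⟩
        refine ⟨hle 0 k c rfl rfl, hks, fun c' hc' x hx => ?_, hpw,
          fun i => hle (i + 1), fun i => hlt (i + 1)⟩
        obtain ⟨i, hi⟩ := List.getElem?_of_mem hc'
        cases i with
        | zero => exact hlt 0 k c' rfl hi x hx
        | succ i =>
          have hik : i < ks.length := by
            have := (List.getElem?_eq_some_iff.1 hi).1
            omega
          exact (hks _ (List.getElem_mem hik)).trans
            (hlt (i + 1) ks[i] c' (by simp [hik]) hi x hx)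

/-- The search for `y` among separators `kl ++ kr` of `cl ++ c :: cr` leads to `c`. -/
structure IsSearchPos (y : K) (kl kr : List K) (cl cr : List α) : Prop where
  length_left : kl.length = cl.length
  length_right : kr.length = cr.length
  lt : ∀ k ∈ kl, k < y
  le : ∀ k ∈ kr, y ≤ k

theorem IsSearchPos.takeWhile_eq (hpos : IsSearchPos y kl kr cl cr) :
    (kl ++ kr).takeWhile (fun k => decide (k < y)) = kl := by
  rw [List.takeWhile_append_of_pos (by simpa using hpos.lt)]
  cases kr with
  | nil => simp
  | cons k kr => simp [not_lt.2 (hpos.le k (by simp))]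

theorem exists_isSearchPos (hks : ks.Pairwise (· < ·)) (hl : cs.length = ks.length + 1) (y : K) :
    ∃ kl kr cl c cr, ks = kl ++ kr ∧ cs = cl ++ c :: cr ∧ IsSearchPos y kl kr cl cr := by
  induction ks generalizing cs with
  | nil =>
    obtain ⟨c, rfl⟩ := List.length_eq_one_iff.1 hl
    exact ⟨[], [], [], c, [], rfl, rfl, by constructor <;> simp⟩
  | cons k ks ih =>
    obtain ⟨c, cs, rfl⟩ := List.exists_cons_of_length_eq_add_one hl
    obtain ⟨hk, hks⟩ := List.pairwise_cons.1 hks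
    by_cases hky : k < y
    · obtain ⟨kl, kr, cl, c', cr, rfl, rfl, hpos⟩ := ih hks (Nat.succ.inj hl)
      refine ⟨k :: kl, kr, c :: cl, c', cr, rfl, rfl, ?_, hpos.length_right, ?_, hpos.le⟩
      · simp [hpos.length_left]
      · simpa [hky] using hpos.lt
    · have hyk := not_lt.1 hky
      refine ⟨[], k :: ks, [], c, cs, rfl, rfl, rfl, (Nat.succ.inj hl).symm, by simp, ?_⟩
      simpa [hyk] using fun k' hk' => hyk.trans (hk k' hk').le

theorem Separates.lt_of_mem_left (h : Separates S (kl ++ kr) (cl ++ c :: cr))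
    (hpos : IsSearchPos y kl kr cl cr) (hc : c' ∈ cl) (hx : x ∈ S c') : x < y := by
  obtain ⟨k, hk, hle⟩ :=
    ((separates_append hpos.length_left).1 h).1.exists_forall_le hpos.length_left hc
  exact (hle x hx).trans_lt (hpos.lt k hk)

theorem Separates.lt_of_mem_right (h : Separates S (kl ++ kr) (cl ++ c :: cr))
    (hpos : IsSearchPos y kl kr cl cr) (hc : c' ∈ cr) (hx : x ∈ S c') : y < x := by
  cases kr with
  | nil => simp [List.length_eq_zero_iff.1 hpos.length_right.symm] at hc
  | cons k kr =>
    exact (hpos.le k (by simp)).trans_lt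
      (((separates_append hpos.length_left).1 h).2.1.2.2.1 c' hc x hx)

theorem Separates.replace (h : Separates S (kl ++ kr) (cl ++ c :: cr))
    (hpos : IsSearchPos y kl kr cl cr) (hc : S c' ⊆ insert y (S c)) :
    Separates S (kl ++ kr) (cl ++ c' :: cr) := by
  rw [separates_append hpos.length_left] at h ⊢
  obtain ⟨hleft, hright, hcross⟩ := h
  refine ⟨hleft, ?_, fun k hk => ⟨(hcross k hk).1, ?_⟩⟩
  · cases kr with
    | nil => trivial
    | cons k kr =>
      refine ⟨fun x hx => ?_, hright.2⟩
      rcases hc hx with rfl | hx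
      · exact hpos.le k (by simp)
      · exact hright.1 x hx
  · have hcross' := (hcross k hk).2
    simp only [List.forall_mem_cons] at hcross' ⊢
    refine ⟨fun x hx => ?_, hcross'.2⟩
    rcases hc hx with rfl | hx
    · exact hpos.lt k hk
    · exact hcross'.1 x hx

theorem Separates.replace_two (h : Separates S (kl ++ kr) (cl ++ c :: cr))
    (hpos : IsSearchPos y kl kr cl cr) (hl : S l ⊆ insert y (S c)) (hr : S r ⊆ insert y (S c))
    (hlk : ∀ x ∈ S l, x ≤ k) (hrk : ∀ x ∈ S r, k < x)
    (hl₀ : (S l).Nonempty) (hr₀ : (S r).Nonempty) :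
    Separates S (kl ++ k :: kr) (cl ++ l :: r :: cr) := by
  obtain ⟨hleft, -, hcrossl⟩ := (separates_append hpos.length_left).1 (h.replace hpos hl)
  obtain ⟨-, hright, hcrossr⟩ := (separates_append hpos.length_left).1 (h.replace hpos hr)
  obtain ⟨a, ha⟩ := hl₀
  obtain ⟨b, hb⟩ := hr₀
  simp only [List.forall_mem_cons] at hcrossl hcrossr
  have hlt_kr : ∀ k' ∈ kr, k < k' := by
    cases kr with
    | nil => simp
    | cons k' kr =>
      have hkk' : k < k' := (hrk b hb).trans_le (hright.1 b hb)
      simpa [hkk'] using fun x hx => hkk'.trans (hright.2.1 x hx)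
  have hlt_cr : ∀ c' ∈ cr, ∀ x ∈ S c', k < x := by
    intro c' hc' x hx
    cases kr with
    | nil => simp [List.length_eq_zero_iff.1 hpos.length_right.symm] at hc'
    | cons k' kr => exact (hlt_kr k' (by simp)).trans (hright.2.2.1 c' hc' x hx)
  have hkl_lt : ∀ k' ∈ kl, k' < k := fun k' hk' =>
    ((hcrossl k' hk').2.1 a ha).trans_le (hlk a ha)
  rw [separates_append hpos.length_left]
  refine ⟨hleft, ⟨hlk, hlt_kr, List.forall_mem_cons.2 ⟨hrk, hlt_cr⟩, hright⟩, fun k' hk' => ?_⟩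
  simp only [List.forall_mem_cons]
  exact ⟨⟨hkl_lt k' hk', (hcrossl k' hk').1⟩, (hcrossl k' hk').2.1, (hcrossr k' hk').2⟩

theorem Separates.left (hl : kl.length = cl.length)
    (h : Separates S (kl ++ k :: kr) (cl ++ c :: cr)) : Separates S kl (cl ++ [c]) := by
  obtain ⟨hleft, -, hcross⟩ := (separates_append hl).1 h
  rw [← List.append_nil kl, separates_append hl]
  exact ⟨hleft, trivial, fun k' hk' => ⟨by simp, by simpa using ((hcross k' hk').2 c (by simp))⟩⟩

theorem Separates.right (hl : kl.length = cl.length)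
    (h : Separates S (kl ++ k :: kr) (cl ++ c :: cr)) : Separates S kr cr :=
  ((separates_append hl).1 h).2.1.2.2.2

theorem Separates.le_of_mem_left (hl : kl.length = cl.length)
    (h : Separates S (kl ++ k :: kr) (cl ++ c :: cr)) (hc : c' ∈ cl ++ [c]) (hx : x ∈ S c') :
    x ≤ k := by
  obtain ⟨hleft, hright, hcross⟩ := (separates_append hl).1 h
  rcases List.mem_append.1 hc with hc | hc
  · obtain ⟨k', hk', hle⟩ := hleft.exists_forall_le hl hc
    exact (hle x hx).trans ((hcross k' hk').1 k (by simp)).le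
  · exact hright.1 x (List.mem_singleton.1 hc ▸ hx)

theorem Separates.lt_of_mem_drop (hl : kl.length = cl.length)
    (h : Separates S (kl ++ k :: kr) (cl ++ c :: cr)) (hc : c' ∈ cr) (hx : x ∈ S c') : k < x :=
  ((separates_append hl).1 h).2.1.2.2.1 c' hc x hx

theorem Separates.isSearchPos_of_mem (hl : kl.length = cl.length) (hr : kr.length = cr.length)
    (h : Separates S (kl ++ kr) (cl ++ c :: cr)) (hx : x ∈ S c) : IsSearchPos x kl kr cl cr where
  length_left := hl
  length_right := hr
  lt k hk := (((separates_append hl).1 h).2.2 k hk).2 c (by simp) x hx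
  le := by
    have hright := ((separates_append hl).1 h).2.1
    cases kr with
    | nil => simp
    | cons k kr =>
      have hxk := hright.1 x hx
      simpa [hxk] using fun k' hk' => hxk.trans (hright.2.1 k' hk').le

/-- The child to which the search for `y` among the separators `ks` of `cs` leads. -/
def searchChild (y : K) (ks : List K) (cs : List α) : Option α :=
  cs[(ks.takeWhile fun k => k < y).length]?

theorem IsSearchPos.searchChild_eq (hpos : IsSearchPos y kl kr cl cr) :
    searchChild y (kl ++ kr) (cl ++ c :: cr) = some c := by
  rw [searchChild, hpos.takeWhile_eq, hpos.length_left]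
  simp

theorem forall_searchChild_replace {P : α → Prop}
    (h : ∀ z ∈ searchChild y ks (cl ++ c :: cr), P z) (hc : P c → P c') :
    ∀ z ∈ searchChild y ks (cl ++ c' :: cr), P z := by
  unfold searchChild at h ⊢
  rcases lt_trichotomy (ks.takeWhile fun k => k < y).length cl.length with hi | hi | hi
  · rwa [List.getElem?_append_left hi] at h ⊢
  · simp only [hi, List.getElem?_append_right le_rfl, Nat.sub_self,
      List.getElem?_cons_zero, Option.mem_some_iff, forall_eq'] at h ⊢
    exact hc h
  · obtain ⟨j, hj⟩ := Nat.exists_eq_add_of_lt hi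
    rw [List.getElem?_append_right hi.le, hj, Nat.add_assoc, Nat.add_sub_cancel_left] at h ⊢
    exact h

theorem searchChild_append_of_le (hl : kl.length = cl.length) (hkr : ∀ k ∈ kr, y ≤ k) :
    searchChild y (kl ++ kr) (cl ++ c :: cr) = searchChild y kl (cl ++ [c]) := by
  have htake : (kl ++ kr).takeWhile (fun k => decide (k < y)) =
      kl.takeWhile fun k => decide (k < y) := by
    have hnil : kr.takeWhile (fun k => decide (k < y)) = [] := by
      cases kr with
      | nil => rfl
      | cons k kr => simp [hkr k (by simp)]
    rw [List.takeWhile_append, hnil, List.append_nil]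
    split_ifs with h
    · exact ((List.takeWhile_prefix _).eq_of_length h).symm
    · rfl
  rw [searchChild, htake, searchChild, List.append_cons, List.getElem?_append_left]
  rw [List.length_append, List.length_singleton, ← hl]
  exact Nat.lt_succ_of_le (List.takeWhile_prefix _).length_le

theorem searchChild_append_of_lt (hl : kl.length = cl.length) (hkl : ∀ k ∈ kl, k < y) :
    searchChild y (kl ++ kr) (cl ++ cr) = searchChild y kr cr := by
  rw [searchChild, List.takeWhile_append_of_pos (by simpa using hkl), List.length_append, hl,
    List.getElem?_append_right (Nat.le_add_right ..), Nat.add_sub_cancel_left, searchChild]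

theorem forall_searchChild_replace_two {P : α → Prop} (hlen : kl.length = cl.length)
    (hk : (kl ++ k :: kr).Pairwise (· < ·))
    (h : ∀ z ∈ searchChild y (kl ++ kr) (cl ++ c :: cr), P z)
    (hl : y ≤ k → P c → P l) (hr : k < y → P c → P r) :
    ∀ z ∈ searchChild y (kl ++ k :: kr) (cl ++ l :: r :: cr), P z := by
  obtain ⟨-, hkr, hkl⟩ := List.pairwise_append.1 hk
  have hlt_kr := (List.pairwise_cons.1 hkr).1
  rcases le_or_gt y k with hy | hy
  · rw [searchChild_append_of_le hlen fun k' hk' => hy.trans (hlt_kr k' hk').le] at h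
    rw [searchChild_append_of_le hlen (List.forall_mem_cons.2 ⟨hy, fun k' hk' =>
      hy.trans (hlt_kr k' hk').le⟩)]
    exact forall_searchChild_replace h (hl hy)
  · have hkl_lt : ∀ k' ∈ kl, k' < y := fun k' hk' => (hkl k' hk' k (by simp)).trans hy
    rw [searchChild_append_of_lt hlen hkl_lt] at h
    rw [List.append_cons kl, List.append_cons cl, searchChild_append_of_lt (by simpa using hlen)
      (by simpa [or_imp, forall_and, hy] using hkl_lt)]
    exact forall_searchChild_replace (cl := []) h (hr hy)

/-- A node of a search tree with between `lo` and `hi` separators `ks` and children `cs`, each of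
which holds the keys `S c` and satisfies `Q c`. -/
structure IsSearchNode (lo hi : ℕ) (S : α → Set K) (Q : α → Prop) (ks : List K) (cs : List α) :
    Prop where
  le_length : lo ≤ ks.length
  length_le : ks.length ≤ hi
  length_kids : cs.length = ks.length + 1
  separates : Separates S ks cs
  forall_kids : ∀ c ∈ cs, Q c

variable {lo hi : ℕ} {Q : α → Prop}

theorem IsSearchNode.map {β : Type*} {g : α → β} {S' : β → Set K} {Q' : β → Prop}
    (h : IsSearchNode lo hi S Q ks cs) (hS : ∀ c, S' (g c) = S c)
    (hQ : ∀ c ∈ cs, Q c → Q' (g c)) : IsSearchNode lo hi S' Q' ks (cs.map g) where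
  le_length := h.le_length
  length_le := h.length_le
  length_kids := by rw [List.length_map, h.length_kids]
  separates := (separates_map hS).2 h.separates
  forall_kids := by simpa using fun c hc => hQ c hc (h.forall_kids c hc)

theorem IsSearchNode.replace (h : IsSearchNode lo hi S Q (kl ++ kr) (cl ++ c :: cr))
    (hpos : IsSearchPos y kl kr cl cr) (hc : S c' ⊆ insert y (S c)) (hQ : Q c') :
    IsSearchNode lo hi S Q (kl ++ kr) (cl ++ c' :: cr) where
  le_length := h.le_length
  length_le := h.length_le
  length_kids := by simpa using h.length_kids
  separates := h.separates.replace hpos hc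
  forall_kids := by
    have := h.forall_kids
    simp_all [or_imp, forall_and]

theorem IsSearchNode.replace_two (h : IsSearchNode lo hi S Q (kl ++ kr) (cl ++ c :: cr))
    (hpos : IsSearchPos y kl kr cl cr) (hl : S l ⊆ insert y (S c)) (hr : S r ⊆ insert y (S c))
    (hlk : ∀ x ∈ S l, x ≤ k) (hrk : ∀ x ∈ S r, k < x)
    (hl₀ : (S l).Nonempty) (hr₀ : (S r).Nonempty) (hQl : Q l) (hQr : Q r) :
    IsSearchNode lo (hi + 1) S Q (kl ++ k :: kr) (cl ++ l :: r :: cr) where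
  le_length := by grind [h.le_length]
  length_le := by grind [h.length_le]
  length_kids := by grind [h.length_kids]
  separates := h.separates.replace_two hpos hl hr hlk hrk hl₀ hr₀
  forall_kids := by
    have := h.forall_kids
    simp_all [or_imp, forall_and]

theorem IsSearchNode.of_length_le {hi' : ℕ} (h : IsSearchNode lo hi S Q ks cs)
    (hle : ks.length ≤ hi') : IsSearchNode lo hi' S Q ks cs :=
  { h with length_le := hle }

theorem IsSearchNode.exists_median (h : IsSearchNode lo hi S Q ks cs) (hks : ks ≠ []) :
    ∃ kl k kr cl c cr, ks = kl ++ k :: kr ∧ cs = cl ++ c :: cr ∧ kl.length = ks.length / 2 ∧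
      kl.length = cl.length := by
  have hpos := List.length_pos_iff.2 hks
  have hl := h.length_kids
  obtain ⟨kl, k, kr, hks', hkl⟩ := exists_eq_append_cons_of_lt (l := ks) (i := ks.length / 2)
    (by omega)
  obtain ⟨cl, c, cr, hcs', hcl⟩ := exists_eq_append_cons_of_lt (l := cs) (i := ks.length / 2)
    (by omega)
  exact ⟨kl, k, kr, cl, c, cr, hks', hcs', hkl, hkl.trans hcl.symm⟩

theorem IsSearchNode.left (h : IsSearchNode lo (hi + 1) S Q (kl ++ k :: kr) (cl ++ c :: cr))
    (hl : kl.length = cl.length) (hlen : hi < (kl ++ k :: kr).length)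
    (hm : kl.length = (kl ++ k :: kr).length / 2) :
    IsSearchNode (hi / 2) hi S Q kl (cl ++ [c]) where
  le_length := by omega
  length_le := by grind [h.length_le]
  length_kids := by simp [hl]
  separates := h.separates.left hl
  forall_kids x hx := h.forall_kids x (by grind)

theorem IsSearchNode.right (h : IsSearchNode lo (hi + 1) S Q (kl ++ k :: kr) (cl ++ c :: cr))
    (hl : kl.length = cl.length) (hlen : hi < (kl ++ k :: kr).length)
    (hm : kl.length = (kl ++ k :: kr).length / 2) : IsSearchNode (hi / 2) hi S Q kr cr where
  le_length := by grind
  length_le := by grind [h.length_le]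
  length_kids := by grind [h.length_kids]
  separates := h.separates.right hl
  forall_kids x hx := h.forall_kids x (by grind)

end separators

/-! ### d-nodes -/

/-- The keys of the entries `es`. -/
def keySet (es : List (Entry K V)) : Set K := {k | ∃ e ∈ es, e.key = k}

@[simp] theorem mem_keySet {es : List (Entry K V)} {k : K} :
    k ∈ keySet es ↔ ∃ e ∈ es, e.key = k := .rfl

theorem forall_mem_keySet {es : List (Entry K V)} {P : K → Prop} :
    (∀ x ∈ keySet es, P x) ↔ ∀ e ∈ es, P e.key := by
  simp

theorem keySet_append (as bs : List (Entry K V)) : keySet (as ++ bs) = keySet as ∪ keySet bs := by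
  ext k
  simp [or_and_right, exists_or]

theorem keySet_nonempty {es : List (Entry K V)} (h : es ≠ []) : (keySet es).Nonempty := by
  obtain ⟨e, he⟩ := List.exists_mem_of_ne_nil es h
  exact ⟨e.key, e, he, rfl⟩

theorem DNode.entries_zero (es : List (Entry K V)) (q : Option ℕ) :
    DNode.entries 0 ⟨es, q⟩ = es := by
  simp [DNode.entries, DNode.leaves]

theorem DNode.entries_succ {n : ℕ} (ks : List K) (cs : List (DNode K V n)) :
    DNode.entries (n + 1) ⟨ks, cs⟩ = cs.flatMap (DNode.entries n) :=
  List.flatMap_assoc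

section order

variable [LinearOrder K]

theorem keySet_insertSorted (e : Entry K V) (es : List (Entry K V)) :
    keySet (insertSorted e es) = insert e.key (keySet es) := by
  ext k
  simp [eq_comm]

/-- The size requirements and the B⁺-tree property for a d-node, which is the root of its d-tree
if `isRoot`, and for all d-nodes below it. -/
def DNode.WellFormed (p : Params) : (n : ℕ) → (isRoot : Bool) → DNode K V n → Prop
  | 0, isRoot, ⟨es, _⟩ =>
      (if isRoot then 0 else (p.B - 1) / 2) ≤ es.length ∧ es.length ≤ p.B - 1 ∧ Ascending es
  | n + 1, isRoot, ⟨ks, cs⟩ =>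
      IsSearchNode (if isRoot then 1 else (p.B' - 1) / 2) (p.B' - 1)
        (fun c => keySet (DNode.entries n c)) (DNode.WellFormed p n false) ks cs

theorem DNode.isSearchNode_iff {p : Params} {n lo hi : ℕ} {ks : List K} {cs : List (DNode K V n)} :
    IsSearchNode lo hi (fun c => keySet (DNode.entries n c))
      (fun c => DNode.SizeReq p n c ∧ DNode.IsBPlus n c) ks cs ↔
    (lo ≤ ks.length ∧ ks.length ≤ hi ∧ ∀ c ∈ cs, DNode.SizeReq p n c) ∧
      DNode.IsBPlus (n + 1) ⟨ks, cs⟩ := by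
  constructor
  · rintro ⟨hlo, hhi, hl, hsep, hcs⟩
    obtain ⟨hpw, hle, hlt⟩ := (separates_iff_getElem? hl).1 hsep
    simp only [forall_mem_keySet] at hle hlt
    exact ⟨⟨hlo, hhi, fun c hc => (hcs c hc).1⟩, hpw, hl, hle, hlt, fun c hc => (hcs c hc).2⟩
  · rintro ⟨⟨hlo, hhi, hsize⟩, hpw, hl, hle, hlt, hbp⟩
    refine ⟨hlo, hhi, hl, (separates_iff_getElem? hl).2 ⟨hpw, ?_, ?_⟩,
      fun c hc => ⟨hsize c hc, hbp c hc⟩⟩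
    · simpa using hle
    · simpa using hlt

theorem DNode.wellFormed_iff {p : Params} {n : ℕ} {t : DNode K V n} :
    DNode.WellFormed p n false t ↔ DNode.SizeReq p n t ∧ DNode.IsBPlus n t := by
  induction n with
  | zero =>
    obtain ⟨es, q⟩ := t
    simp [DNode.WellFormed, DNode.SizeReq, DNode.IsBPlus, ascending_iff_pairwise_map, and_assoc]
  | succ n ih =>
    obtain ⟨ks, cs⟩ := t
    have ih' : DNode.WellFormed p n false = fun c : DNode K V n =>
      DNode.SizeReq p n c ∧ DNode.IsBPlus n c := funext fun c => propext ih
    simp only [DNode.WellFormed, ih', DNode.isSearchNode_iff]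
    rfl

theorem DTree.wellFormed_root_iff {p : Params} {d : DTree K V} :
    DNode.WellFormed p d.height true d.root ↔ d.SizeReq p ∧ d.IsBPlus := by
  rcases d with ⟨_ | n, t⟩
  · simp [DNode.WellFormed, DTree.SizeReq, DTree.IsBPlus, DNode.IsBPlus,
      ascending_iff_pairwise_map]
  · have hchild : DNode.WellFormed p n false = fun c : DNode K V n =>
      DNode.SizeReq p n c ∧ DNode.IsBPlus n c := funext fun c => propext DNode.wellFormed_iff
    simp only [DNode.WellFormed, hchild, DNode.isSearchNode_iff, DTree.SizeReq, DTree.IsBPlus,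
      ← List.length_pos_iff, if_true]
    tauto

theorem Separates.ascending_flatMap {α : Type w} {g : α → List (Entry K V)} {ks : List K}
    {cs : List α} (h : Separates (fun c => keySet (g c)) ks cs) (hl : cs.length = ks.length + 1)
    (hcs : ∀ c ∈ cs, Ascending (g c)) : Ascending (cs.flatMap g) := by
  induction ks generalizing cs with
  | nil =>
    obtain ⟨c, rfl⟩ := List.length_eq_one_iff.1 hl
    simpa using hcs
  | cons k ks ih =>
    obtain ⟨c, cs, rfl⟩ := List.exists_cons_of_length_eq_add_one hl
    rw [List.forall_mem_cons] at hcs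
    refine ascending_append.2 ⟨hcs.1, ih h.2.2.2 (Nat.succ.inj hl) hcs.2, ?_⟩
    intro a ha b hb
    obtain ⟨c', hc', hb⟩ := List.mem_flatMap.1 hb
    exact (h.1 _ ⟨a, ha, rfl⟩).trans_lt (h.2.2.1 c' hc' _ ⟨b, hb, rfl⟩)

theorem DNode.WellFormed.ascending {p : Params} {n : ℕ} {isRoot : Bool} {t : DNode K V n}
    (h : DNode.WellFormed p n isRoot t) : Ascending (DNode.entries n t) := by
  induction n generalizing isRoot with
  | zero =>
    rw [DNode.entries_zero]
    exact h.2.2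
  | succ n ih =>
    rw [DNode.entries_succ]
    exact h.separates.ascending_flatMap h.length_kids fun c hc => ih (h.forall_kids c hc)

theorem DNode.WellFormed.leaves_ne_nil {p : Params} (hB : 3 ≤ p.B) {n : ℕ} {t : DNode K V n}
    (h : DNode.WellFormed p n false t) : ∀ l ∈ DNode.leaves n t, l.1 ≠ [] := by
  induction n with
  | zero =>
    obtain ⟨es, q⟩ := t
    have hlo : (p.B - 1) / 2 ≤ es.length := h.1
    have hpos : 0 < es.length := by omega
    simpa [DNode.leaves] using List.length_pos_iff.1 hpos
  | succ n ih =>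
    simp only [DNode.leaves, List.mem_flatMap, forall_exists_index, and_imp]
    exact fun l c hc hl => ih (h.forall_kids c hc) l hl

theorem DNode.WellFormed.leaves_ne_nil_of_pos {p : Params} (hB : 3 ≤ p.B) {n : ℕ} {isRoot : Bool}
    {t : DNode K V (n + 1)} (h : DNode.WellFormed p (n + 1) isRoot t) :
    ∀ l ∈ DNode.leaves (n + 1) t, l.1 ≠ [] := by
  simp only [DNode.leaves, List.mem_flatMap, forall_exists_index, and_imp]
  exact fun l c hc hl => (h.forall_kids c hc).leaves_ne_nil hB l hl

theorem DNode.WellFormed.exists_leaf {p : Params} {n : ℕ} {isRoot : Bool} {t : DNode K V n}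
    (h : DNode.WellFormed p n isRoot t) : DNode.leaves n t ≠ [] := by
  induction n generalizing isRoot with
  | zero => simp [DNode.leaves]
  | succ n ih =>
    obtain ⟨c, cs, hcs⟩ := List.exists_cons_of_length_eq_add_one h.length_kids
    obtain ⟨l, hl⟩ := List.exists_mem_of_ne_nil _ (ih (h.forall_kids c (by simp [hcs])))
    exact List.ne_nil_of_mem (List.mem_flatMap.2 ⟨c, by simp [hcs], hl⟩)

theorem DNode.WellFormed.entries_ne_nil {p : Params} (hB : 3 ≤ p.B) {n : ℕ} {t : DNode K V n}
    (h : DNode.WellFormed p n false t) : DNode.entries n t ≠ [] := by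
  obtain ⟨l, hl⟩ := List.exists_mem_of_ne_nil _ h.exists_leaf
  obtain ⟨e, he⟩ := List.exists_mem_of_ne_nil _ (h.leaves_ne_nil hB l hl)
  exact List.ne_nil_of_mem (List.mem_flatMap.2 ⟨l, hl, he⟩)

/-! ### Insertion into a d-node -/

/-- `ls'` arises from the leaf d-nodes `ls` by insertion of `e` into one of them, which is replaced
by one or several leaf d-nodes.  Their pointers are set so that no pointer elsewhere has to change,
unless `e` is an s-key. -/
inductive LeafInsertion (e : Entry K V) : LeafList K V → LeafList K V → Prop
  | replace {as bs new : LeafList K V} {es : List (Entry K V)} {q : Option ℕ}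
      (lt : ∀ x ∈ as.flatMap Prod.fst, x.key < e.key)
      (gt : ∀ x ∈ bs.flatMap Prod.fst, e.key < x.key)
      (entries : new.flatMap Prod.fst = insertSorted e es)
      (threaded : Threaded q new) :
      LeafInsertion e (as ++ (es, q) :: bs) (as ++ (new ++ bs))

theorem insertSorted_append_append {e : Entry K V} {as es bs : List (Entry K V)}
    (has : ∀ x ∈ as, x.key < e.key) (hbs : ∀ x ∈ bs, e.key < x.key) :
    insertSorted e (as ++ (es ++ bs)) = as ++ (insertSorted e es ++ bs) := by
  induction as with
  | nil =>
    induction es with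
    | nil => simpa [insertSorted] using insertSorted_append (as := []) (by simp) hbs
    | cons x es ih => simp only [List.nil_append, List.cons_append, insertSorted] at *; grind
  | cons a as ih =>
    simp only [List.forall_mem_cons] at has
    simp [insertSorted, has.1.le, ih has.2]

theorem LeafInsertion.flatMap_fst {e : Entry K V} {ls ls' : LeafList K V}
    (h : LeafInsertion e ls ls') :
    ls'.flatMap Prod.fst = insertSorted e (ls.flatMap Prod.fst) := by
  obtain ⟨lt, gt, entries, -⟩ := h
  simp [entries, insertSorted_append_append lt gt]

theorem LeafInsertion.append {e : Entry K V} {ls ls' as bs : LeafList K V}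
    (h : LeafInsertion e ls ls') (has : ∀ x ∈ as.flatMap Prod.fst, x.key < e.key)
    (hbs : ∀ x ∈ bs.flatMap Prod.fst, e.key < x.key) :
    LeafInsertion e (as ++ (ls ++ bs)) (as ++ (ls' ++ bs)) := by
  obtain ⟨lt, gt, entries, threaded⟩ := h
  simp only [List.append_assoc, List.cons_append]
  rw [← List.append_assoc as, ← List.append_assoc as]
  refine .replace ?_ ?_ entries threaded
  · rw [List.flatMap_append]
    exact List.forall_mem_append.2 ⟨has, lt⟩
  · rw [List.flatMap_append]
    exact List.forall_mem_append.2 ⟨gt, hbs⟩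

theorem LeafInsertion.threaded {e : Entry K V} (he : e.ptr = none) {last : Option ℕ}
    {ls ls' : LeafList K V} (h : LeafInsertion e ls ls') (hls : Threaded last ls) :
    Threaded last ls' := by
  obtain ⟨-, -, entries, threaded⟩ := h
  simp only [threaded_append, Threaded, List.flatMap_cons, nextPtr_append] at hls
  obtain ⟨has, rfl, hbs⟩ := hls
  simpa [threaded_append, entries, nextPtr_insertSorted he] using ⟨has, threaded, hbs⟩

end order

/-- The d-node with keys `ks` and children `cs`, cut at its middle key if it is overfull. -/
def DNode.cut (p : Params) {n : ℕ} (ks : List K) (cs : List (DNode K V n)) : DRes K V (n + 1) :=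
  if ks.length ≤ p.B' - 1 then .one ⟨ks, cs⟩
  else
    match ks[ks.length / 2]? with
    | some x => .two ⟨ks.take (ks.length / 2), cs.take (ks.length / 2 + 1)⟩ x
        ⟨ks.drop (ks.length / 2 + 1), cs.drop (ks.length / 2 + 1)⟩
    | none => .one ⟨ks, cs⟩

theorem DNode.cut_append {p : Params} {n : ℕ} {kl kr : List K} {k : K} {cl cr : List (DNode K V n)}
    {c : DNode K V n} (hl : kl.length = cl.length) (hlen : p.B' - 1 < (kl ++ k :: kr).length)
    (hm : kl.length = (kl ++ k :: kr).length / 2) :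
    DNode.cut p (kl ++ k :: kr) (cl ++ c :: cr) = .two ⟨kl, cl ++ [c]⟩ k ⟨kr, cr⟩ := by
  rw [DNode.cut, if_neg hlen.not_ge, ← hm]
  simp [hl, List.take_append, List.drop_append]

section order

variable [LinearOrder K]

/-- What a correct insertion of `e` below the d-node `t` may return. -/
inductive DNode.InsertResult (p : Params) (e : Entry K V) (n : ℕ) (isRoot : Bool)
    (t : DNode K V n) : DRes K V n → Prop
  | one {t' : DNode K V n} (wellFormed : DNode.WellFormed p n isRoot t')
      (leaves : LeafInsertion e (DNode.leaves n t) (DNode.leaves n t')) :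
      InsertResult p e n isRoot t (.one t')
  | two {l r : DNode K V n} {k : K}
      (left : DNode.WellFormed p n false l) (right : DNode.WellFormed p n false r)
      (le : ∀ x ∈ keySet (DNode.entries n l), x ≤ k)
      (lt : ∀ x ∈ keySet (DNode.entries n r), k < x)
      (leaves : LeafInsertion e (DNode.leaves n t) (DNode.leaves n l ++ DNode.leaves n r)) :
      InsertResult p e n isRoot t (.two l k r)

theorem DNode.insert_zero_of_cut {p : Params} {e x : Entry K V} {es low high : List (Entry K V)}
    {q : Option ℕ} (hcut : insertSorted e es = low ++ x :: high)
    (hlen : p.B - 1 < (insertSorted e es).length)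
    (hm : low.length + 1 = (insertSorted e es).length / 2) :
    DNode.insert p e 0 ⟨es, q⟩ =
      .two ⟨low ++ [x], nextPtr high q⟩ x.key ⟨high, q⟩ := by
  rw [DNode.insert, if_neg hlen.not_ge, ← hm, hcut]
  simp [List.take_append, List.drop_append, List.drop_eq_nil_of_le]

theorem DNode.WellFormed.insert_leaf {p : Params} (hB : 3 ≤ p.B) {isRoot : Bool} {e : Entry K V}
    {t : DNode K V 0} (h : DNode.WellFormed p 0 isRoot t)
    (he : e.key ∉ keySet (DNode.entries 0 t)) :
    DNode.InsertResult p e 0 isRoot t (DNode.insert p e 0 t) := by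
  obtain ⟨es, q⟩ := t
  obtain ⟨hlo, hhi, hasc⟩ := h
  replace hasc := hasc.insertSorted (e := e) (by simpa [DNode.entries_zero] using he)
  have hlen := length_insertSorted e es
  have hleaves {new : LeafList K V} (hnew : new.flatMap Prod.fst = insertSorted e es)
      (hthr : Threaded q new) : LeafInsertion e [(es, q)] new := by
    simpa using LeafInsertion.replace (as := []) (bs := []) (by simp) (by simp) hnew hthr
  by_cases hfit : (insertSorted e es).length ≤ p.B - 1
  · rw [DNode.insert, if_pos hfit]
    exact .one ⟨hlo.trans (by omega), hfit, hasc⟩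
      (hleaves (new := [(insertSorted e es, q)]) (by simp) (by simp [Threaded]))
  · obtain ⟨low, x, high, hcut, hm⟩ : ∃ low x high, insertSorted e es = low ++ x :: high ∧
        low.length + 1 = (insertSorted e es).length / 2 := by
      obtain ⟨low, x, high, hcut, hlow⟩ := exists_eq_append_cons_of_lt
        (show (insertSorted e es).length / 2 - 1 < (insertSorted e es).length by omega)
      exact ⟨low, x, high, hcut, by omega⟩
    rw [DNode.insert_zero_of_cut hcut (not_le.1 hfit) hm]
    rw [List.append_cons] at hcut
    rw [hcut] at hasc hlen hleaves hfit hm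
    obtain ⟨hasc_low, hasc_high, hlt⟩ := ascending_append.1 hasc
    simp only [List.length_append, List.length_singleton] at hlen hfit hm
    refine .two ⟨by simp; omega, by simp; omega, hasc_low⟩ ⟨by simp; omega, by omega, hasc_high⟩
      ?_ ?_ (hleaves (by simp [DNode.leaves]) (by simp [DNode.leaves, Threaded]))
    · rw [forall_mem_keySet, DNode.entries_zero]
      exact hasc_low.le_of_mem_concat
    · rw [forall_mem_keySet, DNode.entries_zero]
      exact hlt x (by simp)

theorem DNode.insert_succ_of_one {p : Params} {e : Entry K V} {n : ℕ} {kl kr : List K}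
    {cl cr : List (DNode K V n)} {c c' : DNode K V n} (hpos : IsSearchPos e.key kl kr cl cr)
    (hc : DNode.insert p e n c = .one c') :
    DNode.insert p e (n + 1) ⟨kl ++ kr, cl ++ c :: cr⟩ = .one ⟨kl ++ kr, cl ++ c' :: cr⟩ := by
  simp [DNode.insert, hpos.takeWhile_eq, hpos.length_left, hc]

theorem DNode.insert_succ_of_two {p : Params} {e : Entry K V} {n : ℕ} {kl kr : List K} {k : K}
    {cl cr : List (DNode K V n)} {c l r : DNode K V n} (hpos : IsSearchPos e.key kl kr cl cr)
    (hc : DNode.insert p e n c = .two l k r) :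
    DNode.insert p e (n + 1) ⟨kl ++ kr, cl ++ c :: cr⟩ =
      DNode.cut p (kl ++ k :: kr) (cl ++ l :: r :: cr) := by
  have hks : (kl ++ kr).take cl.length = kl := List.take_left' hpos.length_left
  have hks' : (kl ++ kr).drop cl.length = kr := List.drop_left' hpos.length_left
  have hcs : (cl ++ c :: cr).drop (cl.length + 1) = cr := by rw [← List.drop_drop]; simp
  have hget : (cl ++ c :: cr)[cl.length]? = some c := by simp
  simp only [DNode.insert, hpos.takeWhile_eq, hpos.length_left, hget, hc, hks, hks', hcs,
    List.take_left]
  rfl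

theorem DNode.insertResult_cut {p : Params} {e : Entry K V} {n lo : ℕ} {isRoot : Bool}
    {ks : List K} {cs : List (DNode K V n)} {t : DNode K V (n + 1)}
    (hlo : (if isRoot then 1 else (p.B' - 1) / 2) ≤ lo)
    (h : IsSearchNode lo (p.B' - 1 + 1) (fun c => keySet (DNode.entries n c))
      (DNode.WellFormed p n false) ks cs)
    (hleaves : LeafInsertion e (DNode.leaves (n + 1) t) (DNode.leaves (n + 1) ⟨ks, cs⟩)) :
    DNode.InsertResult p e (n + 1) isRoot t (DNode.cut p ks cs) := by
  by_cases hfit : ks.length ≤ p.B' - 1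
  · rw [DNode.cut, if_pos hfit]
    exact .one { h.of_length_le hfit with le_length := hlo.trans h.le_length } hleaves
  · have hlen := not_le.1 hfit
    obtain ⟨kl, k, kr, cl, c, cr, rfl, rfl, hm, hl⟩ :=
      h.exists_median (List.ne_nil_of_length_pos (by omega))
    rw [DNode.cut_append hl hlen hm]
    refine .two (h.left hl hlen hm) (h.right hl hlen hm) ?_ ?_ ?_
    · rw [DNode.entries_succ, forall_mem_keySet]
      intro y hy
      obtain ⟨c', hc', hy⟩ := List.mem_flatMap.1 hy
      exact h.separates.le_of_mem_left hl hc' ⟨y, hy, rfl⟩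
    · rw [DNode.entries_succ, forall_mem_keySet]
      intro y hy
      obtain ⟨c', hc', hy⟩ := List.mem_flatMap.1 hy
      exact h.separates.lt_of_mem_drop hl hc' ⟨y, hy, rfl⟩
    · simpa [DNode.leaves] using hleaves

theorem DNode.WellFormed.insert_succ {p : Params} (hB : 3 ≤ p.B) {n : ℕ} {isRoot : Bool}
    {e : Entry K V} {kl kr : List K} {cl cr : List (DNode K V n)} {c : DNode K V n}
    (h : DNode.WellFormed p (n + 1) isRoot ⟨kl ++ kr, cl ++ c :: cr⟩)
    (hpos : IsSearchPos e.key kl kr cl cr)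
    (hc : DNode.InsertResult p e n false c (DNode.insert p e n c)) :
    DNode.InsertResult p e (n + 1) isRoot ⟨kl ++ kr, cl ++ c :: cr⟩
      (DNode.insert p e (n + 1) ⟨kl ++ kr, cl ++ c :: cr⟩) := by
  have hlift {new : LeafList K V} (hnew : LeafInsertion e (DNode.leaves n c) new) :
      LeafInsertion e (DNode.leaves (n + 1) ⟨kl ++ kr, cl ++ c :: cr⟩)
        (cl.flatMap (DNode.leaves n) ++ (new ++ cr.flatMap (DNode.leaves n))) := by
    simp only [DNode.leaves, List.flatMap_append, List.flatMap_cons]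
    refine hnew.append (fun x hx => ?_) fun x hx => ?_
    · obtain ⟨c', hc', hx⟩ := List.mem_flatMap.1 (List.flatMap_assoc ▸ hx)
      exact h.separates.lt_of_mem_left hpos hc' ⟨x, hx, rfl⟩
    · obtain ⟨c', hc', hx⟩ := List.mem_flatMap.1 (List.flatMap_assoc ▸ hx)
      exact h.separates.lt_of_mem_right hpos hc' ⟨x, hx, rfl⟩
  generalize hres : DNode.insert p e n c = res at hc
  cases hc with
  | one hwf hleaves =>
    rw [DNode.insert_succ_of_one hpos hres]
    refine .one (IsSearchNode.replace h hpos ?_ hwf) ?_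
    · rw [DNode.entries, hleaves.flatMap_fst, keySet_insertSorted]
      exact subset_rfl
    · simpa [DNode.leaves] using hlift hleaves
  | @two l r k hwl hwr hle hlt hleaves =>
    rw [DNode.insert_succ_of_two hpos hres]
    have hkeys : keySet (DNode.entries n l) ∪ keySet (DNode.entries n r) =
        Insert.insert e.key (keySet (DNode.entries n c)) := by
      rw [← keySet_append, ← keySet_insertSorted, DNode.entries, DNode.entries,
        ← List.flatMap_append, hleaves.flatMap_fst, DNode.entries]
    have hnode := IsSearchNode.replace_two h hpos (Set.subset_union_left.trans hkeys.subset)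
      (Set.subset_union_right.trans hkeys.subset) hle hlt
      (keySet_nonempty (hwl.entries_ne_nil hB)) (keySet_nonempty (hwr.entries_ne_nil hB)) hwl hwr
    refine DNode.insertResult_cut le_rfl hnode ?_
    simpa [DNode.leaves] using hlift hleaves

theorem DNode.WellFormed.insert {p : Params} (hB : 3 ≤ p.B) {n : ℕ}
    {isRoot : Bool} {e : Entry K V} {t : DNode K V n} (h : DNode.WellFormed p n isRoot t)
    (he : e.key ∉ keySet (DNode.entries n t)) :
    DNode.InsertResult p e n isRoot t (DNode.insert p e n t) := by
  induction n generalizing isRoot with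
  | zero => exact h.insert_leaf hB he
  | succ n ih =>
    obtain ⟨ks, cs⟩ := t
    obtain ⟨kl, kr, cl, c, cr, rfl, rfl, hpos⟩ :=
      exists_isSearchPos h.separates.pairwise h.length_kids e.key
    refine h.insert_succ hB hpos (ih (h.forall_kids c (by simp)) fun hc => he ?_)
    rw [DNode.entries_succ]
    obtain ⟨x, hx, hxe⟩ := hc
    exact ⟨x, by simp [hx], hxe⟩

end order

/-! ### d-trees -/

theorem DNode.leaves_mapPtr (g : List (Entry K V) → Option ℕ → Option ℕ) (n : ℕ)
    (t : DNode K V n) : DNode.leaves n (DNode.mapPtr g n t) =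
      (DNode.leaves n t).map fun l => (l.1, g l.1 l.2) := by
  induction n with
  | zero => rfl
  | succ n ih => simp [DNode.leaves, DNode.mapPtr, List.flatMap_map, List.map_flatMap, ih]

theorem DNode.entries_mapPtr (g : List (Entry K V) → Option ℕ → Option ℕ) (n : ℕ)
    (t : DNode K V n) : DNode.entries n (DNode.mapPtr g n t) = DNode.entries n t := by
  simp [DNode.entries, DNode.leaves_mapPtr, List.flatMap_map]

@[simp] theorem DTree.entries_empty (q : Option ℕ) : (DTree.empty q : DTree K V).entries = [] :=
  rfl

theorem nextPtr_filter {P : Entry K V → Bool} {es : List (Entry K V)}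
    (h : ∀ y ∈ es, y.ptr.isSome → P y) (q : Option ℕ) : nextPtr (es.filter P) q = nextPtr es q := by
  induction es with
  | nil => rfl
  | cons y es ih =>
    rw [List.forall_mem_cons] at h
    by_cases hy : P y
    · simp [hy, ih h.2]
    · have hptr : y.ptr = none := by simpa using mt h.1 hy
      simp [hy, hptr, ih h.2]

section order

variable [LinearOrder K]

theorem DNode.WellFormed.mapPtr {p : Params} {g : List (Entry K V) → Option ℕ → Option ℕ}
    {n : ℕ} {isRoot : Bool} {t : DNode K V n} (h : DNode.WellFormed p n isRoot t) :
    DNode.WellFormed p n isRoot (DNode.mapPtr g n t) := by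
  induction n generalizing isRoot with
  | zero => exact h
  | succ n ih => exact IsSearchNode.map h (fun c => by rw [entries_mapPtr]) fun _ _ => ih

/-- The size requirements and the B⁺-tree property for a d-tree, and the correctness of the slots
`P_{s-node}` with respect to the pointer `last` to the last child s-node. -/
structure DTree.WellFormed (p : Params) (last : Option ℕ) (d : DTree K V) : Prop where
  root : DNode.WellFormed p d.height true d.root
  threaded : Threaded last d.leaves

theorem DTree.wellFormed_iff {p : Params} {last : Option ℕ} {d : DTree K V} :
    d.WellFormed p last ↔ (d.SizeReq p ∧ d.IsBPlus) ∧ Threaded last d.leaves :=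
  ⟨fun h => ⟨DTree.wellFormed_root_iff.1 h.root, h.threaded⟩,
    fun h => ⟨DTree.wellFormed_root_iff.2 h.1, h.2⟩⟩

theorem DTree.WellFormed.ascending {p : Params} {last : Option ℕ} {d : DTree K V}
    (h : d.WellFormed p last) : Ascending d.entries :=
  h.root.ascending

theorem DTree.WellFormed.lastPtr_eq {p : Params} {last : Option ℕ} {d : DTree K V}
    (h : d.WellFormed p last) : d.lastPtr = last := by
  have hne : d.leaves ≠ [] := h.root.exists_leaf
  obtain ⟨ls, l, hd⟩ := (List.eq_nil_or_concat d.leaves).resolve_left hne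
  have hthr := h.threaded
  rw [List.concat_eq_append] at hd
  rw [hd, threaded_append] at hthr
  simpa [DTree.lastPtr, hd] using hthr.2.1

theorem DTree.wellFormed_empty (p : Params) (q : Option ℕ) :
    (DTree.empty q : DTree K V).WellFormed p q where
  root := ⟨by simp, by simp, .nil⟩
  threaded := ⟨rfl, trivial⟩

theorem DTree.insert_spec {p : Params} (hB : 3 ≤ p.B) (hB' : 2 ≤ p.B') {d : DTree K V}
    {e : Entry K V} (h : DNode.WellFormed p d.height true d.root) (he : e.key ∉ keySet d.entries) :
    DNode.WellFormed p (d.insert p e).height true (d.insert p e).root ∧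
      LeafInsertion e d.leaves (d.insert p e).leaves := by
  have hres := h.insert hB he
  generalize hins : DNode.insert p e d.height d.root = res at hres
  cases hres with
  | @one t' hwf hleaves =>
    have heq : d.insert p e = ⟨d.height, t'⟩ := by rw [DTree.insert, hins]
    rw [heq]
    exact ⟨hwf, hleaves⟩
  | @two l r k hwl hwr hle hlt hleaves =>
    have heq : d.insert p e = ⟨d.height + 1, ⟨[k], [l, r]⟩⟩ := by rw [DTree.insert, hins]
    rw [heq]
    refine ⟨⟨by simp, by simp; omega, rfl, ?_, by simp [hwl, hwr]⟩, ?_⟩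
    · exact ⟨hle, by simp, by simpa using hlt, trivial⟩
    · simpa [DTree.leaves, DNode.leaves] using hleaves

theorem DTree.WellFormed.entries_insert {p : Params} (hB : 3 ≤ p.B) (hB' : 2 ≤ p.B')
    {last : Option ℕ} {d : DTree K V} {e : Entry K V} (h : d.WellFormed p last)
    (he : e.key ∉ keySet d.entries) : (d.insert p e).entries = insertSorted e d.entries :=
  (DTree.insert_spec hB hB' h.root he).2.flatMap_fst

theorem DTree.WellFormed.insert {p : Params} (hB : 3 ≤ p.B) (hB' : 2 ≤ p.B') {last : Option ℕ}
    {d : DTree K V} {e : Entry K V} (h : d.WellFormed p last) (he : e.key ∉ keySet d.entries)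
    (hptr : e.ptr = none) : (d.insert p e).WellFormed p last where
  root := (DTree.insert_spec hB hB' h.root he).1
  threaded := (DTree.insert_spec hB hB' h.root he).2.threaded hptr h.threaded

/-! ### Insertion of an s-key into a d-tree -/

/-- The slot `P_{s-node}` of the leaf d-node `l` leads to the child s-node that belongs to the first
s-key among the entries `es` beyond the largest key of `l`.  For the leaves of one d-tree this is a
form of `Threaded` that refers to one leaf at a time. -/
def PointsPast (es : List (Entry K V)) (last : Option ℕ) (l : List (Entry K V) × Option ℕ) : Prop :=
  ∀ x ∈ l.1.getLast?, l.2 = nextPtr (es.filter fun y => x.key < y.key) last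

theorem Ascending.filter_getLast_lt {as bs cs : List (Entry K V)} {x : Entry K V}
    (h : Ascending (as ++ (bs ++ cs))) (hx : x ∈ bs.getLast?) :
    (as ++ (bs ++ cs)).filter (fun y => x.key < y.key) = cs := by
  obtain ⟨bs, rfl⟩ := List.getLast?_eq_some_iff.1 hx
  have hcut : as ++ (bs ++ [x] ++ cs) = (as ++ bs) ++ x :: cs := by simp
  rw [hcut] at h ⊢
  exact h.filter_lt_key

theorem Threaded.pointsPast {last : Option ℕ} {ls : LeafList K V} (h : Threaded last ls)
    {pre : List (Entry K V)} (hasc : Ascending (pre ++ ls.flatMap Prod.fst)) :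
    ∀ l ∈ ls, PointsPast (pre ++ ls.flatMap Prod.fst) last l := by
  induction ls generalizing pre with
  | nil => simp
  | cons l ls ih =>
    rw [List.flatMap_cons] at hasc ⊢
    refine List.forall_mem_cons.2 ⟨fun x hx => ?_, ?_⟩
    · rw [hasc.filter_getLast_lt hx, h.1]
    · rw [← List.append_assoc] at hasc ⊢
      exact ih h.2 hasc

theorem threaded_of_forall_pointsPast {last : Option ℕ} {pre : List (Entry K V)}
    {ls : LeafList K V} (hne : ∀ l ∈ ls, l.1 ≠ [])
    (hasc : Ascending (pre ++ ls.flatMap Prod.fst))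
    (h : ∀ l ∈ ls, PointsPast (pre ++ ls.flatMap Prod.fst) last l) : Threaded last ls := by
  induction ls generalizing pre with
  | nil => trivial
  | cons l ls ih =>
    rw [List.flatMap_cons] at hasc h
    rw [List.forall_mem_cons] at h hne
    refine ⟨?_, ?_⟩
    · have hx := List.getLast?_eq_some_getLast hne.1
      rw [h.1 _ hx, hasc.filter_getLast_lt hx]
    · rw [← List.append_assoc] at hasc h
      exact ih hne.2 hasc h.2

/-- The new value of the slot `P_{s-node}`, so far `q`, of a leaf d-node with entries `es` after
insertion of the s-key `e` into a d-tree with entries `all`, as described at `DTree.insertS`. -/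
def redirect (e : Entry K V) (hiPtr : Option ℕ) (all es : List (Entry K V)) (q : Option ℕ) :
    Option ℕ :=
  match es.getLast? with
  | none => q
  | some x =>
    if x.key < e.key then
      if ∀ y ∈ sKeys all, y.key < e.key → y.key ≤ x.key then e.ptr else q
    else if ∀ y ∈ sKeys all, e.key < y.key → x.key < y.key then hiPtr else q

theorem Ascending.match_getLast? {es : List (Entry K V)} (h : Ascending es) (k : K)
    (q q' : Option ℕ) :
    (match es.getLast?.map Entry.key with
      | none => q
      | some k' => if k' ≤ k then q else q') = if ∀ y ∈ es, y.key ≤ k then q else q' := by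
  obtain rfl | ⟨es, x, rfl⟩ := List.eq_nil_or_concat' es
  · simp
  · have hiff : (∀ y ∈ es ++ [x], y.key ≤ k) ↔ x.key ≤ k :=
      ⟨fun hall => hall x (by simp), fun hk y hy => (h.le_of_mem_concat y hy).trans hk⟩
    simp only [List.getLast?_concat, Option.map_some, hiff]

theorem Ascending.match_head? {es : List (Entry K V)} (h : Ascending es) (k : K)
    (q q' : Option ℕ) :
    (match es.head?.map Entry.key with
      | none => q
      | some k' => if k < k' then q else q') = if ∀ y ∈ es, k < y.key then q else q' := by
  cases es with
  | nil => simp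
  | cons x es =>
    have hiff : (∀ y ∈ x :: es, k < y.key) ↔ k < x.key :=
      ⟨fun hall => hall x (by simp), fun hk => List.forall_mem_cons.2
        ⟨hk, fun y hy => hk.trans ((List.pairwise_cons.1 h).1 y hy)⟩⟩
    simp only [List.head?_cons, Option.map_some, hiff]

theorem DTree.insertS_eq {p : Params} {e : Entry K V} {hiPtr : Option ℕ} {d : DTree K V}
    (h : Ascending d.entries) : d.insertS p e hiPtr =
      ⟨(d.insert p e).height,
        DNode.mapPtr (redirect e hiPtr d.entries) _ (d.insert p e).root⟩ := by
  have hsk (P : Entry K V → Bool) : Ascending ((sKeys d.entries).filter P) :=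
    (h.sublist List.filter_sublist).sublist List.filter_sublist
  unfold DTree.insertS
  dsimp only
  congr
  funext es q
  rw [redirect]
  cases es.getLast? with
  | none => rfl
  | some x =>
    refine congrArg₂ (ite _) (((hsk _).match_getLast? x.key _ _).trans ?_)
      (((hsk _).match_head? x.key _ _).trans ?_) <;>
    simp only [List.mem_filter, decide_eq_true_eq, and_imp]

section redirect

variable {e : Entry K V} {as bs es : List (Entry K V)} {q last last' : Option ℕ} {x : Entry K V}

theorem redirect_of_lt (he : e.ptr.isSome) (has : ∀ y ∈ as, y.key < e.key)
    (hbs : ∀ y ∈ bs, e.key < y.key) (hiPtr : Option ℕ) (hx : x ∈ es.getLast?) (hxe : x.key < e.key)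
    (hq : q = nextPtr ((as ++ bs).filter fun y => x.key < y.key) last ∨
      q = nextPtr ((as ++ e :: bs).filter fun y => x.key < y.key) last) :
    redirect e hiPtr (as ++ bs) es q =
      nextPtr ((as ++ e :: bs).filter fun y => x.key < y.key) last' := by
  have hfilter : (e :: bs).filter (fun y => x.key < y.key) = e :: bs := by
    simpa [List.filter_eq_self, hxe] using fun y hy => hxe.trans (hbs y hy)
  simp only [List.filter_append] at hq ⊢
  simp only [redirect, Option.mem_def.1 hx]
  rw [if_pos hxe, hfilter]
  split_ifs with hall
  · rw [nextPtr_append, nextPtr_of_forall_none, nextPtr_cons]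
    · rw [Option.or_of_isSome he]
    · intro y hy
      simp only [List.mem_filter, decide_eq_true_eq] at hy
      by_contra hptr
      rw [← ne_eq, ← Option.isSome_iff_ne_none] at hptr
      exact (hall y (by simp [hy.1, hptr]) (has y hy.1)).not_gt hy.2
  · push Not at hall
    obtain ⟨y, hy, hye, hxy⟩ := hall
    have hmem : ∃ y ∈ as.filter fun y => x.key < y.key, y.ptr.isSome := by
      obtain ⟨hyE, hptr⟩ := mem_sKeys.1 hy
      have hyas := (List.mem_append.1 hyE).resolve_right fun hyb => (hbs y hyb).not_gt hye
      exact ⟨y, by simpa using ⟨hyas, hxy⟩, hptr⟩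
    simp only [nextPtr_append] at hq ⊢
    rcases hq with hq | hq <;> exact hq.trans (nextPtr_congr_of_exists_isSome hmem ..)

theorem redirect_of_ge (has : ∀ y ∈ as, y.key < e.key) (hbs : ∀ y ∈ bs, e.key < y.key)
    (hlast : last' = last ∨ ∀ y ∈ bs, y.ptr = none) (hx : x ∈ es.getLast?) (hex : e.key ≤ x.key)
    (hq : q = nextPtr ((as ++ bs).filter fun y => x.key < y.key) last ∨
      q = nextPtr ((as ++ e :: bs).filter fun y => x.key < y.key) last) :
    redirect e (nextPtr bs last') (as ++ bs) es q =
      nextPtr ((as ++ e :: bs).filter fun y => x.key < y.key) last' := by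
  have hfilter : (e :: bs).filter (fun y => x.key < y.key) =
    bs.filter (fun y => x.key < y.key) := by simp [hex]
  have hnil : as.filter (fun y => x.key < y.key) = [] := by
    simpa using fun y hy => ((has y hy).trans_le hex).le
  simp only [List.filter_append, hfilter, hnil, List.nil_append, or_self] at hq ⊢
  simp only [redirect, Option.mem_def.1 hx]
  rw [if_neg hex.not_gt]
  split_ifs with hall
  · refine (nextPtr_filter (fun y hy hptr => ?_) _).symm
    simpa using hall y (by simp [hy, hptr]) (hbs y hy)
  · push Not at hall
    obtain ⟨y, hy, hey, -⟩ := hall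
    obtain ⟨hyE, hptr⟩ := mem_sKeys.1 hy
    have hybs := (List.mem_append.1 hyE).resolve_left fun hya => (has y hya).not_gt hey
    rw [hq, hlast.resolve_right fun hnone => by simp [hnone y hybs] at hptr]

theorem pointsPast_redirect (he : e.ptr.isSome) (has : ∀ y ∈ as, y.key < e.key)
    (hbs : ∀ y ∈ bs, e.key < y.key) (hlast : last' = last ∨ ∀ y ∈ bs, y.ptr = none)
    {l : List (Entry K V) × Option ℕ}
    (hl : PointsPast (as ++ bs) last l ∨ PointsPast (as ++ e :: bs) last l) :
    PointsPast (as ++ e :: bs) last'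
      (l.1, redirect e (nextPtr bs last') (as ++ bs) l.1 l.2) := by
  intro x hx
  replace hl := hl.imp (fun h => h x hx) fun h => h x hx
  rcases lt_or_ge x.key e.key with hxe | hex
  · exact redirect_of_lt he has hbs _ hx hxe hl
  · exact redirect_of_ge has hbs hlast hx hex hl

end redirect

theorem LeafInsertion.forall_pointsPast {e : Entry K V} {ls ls' : LeafList K V}
    (h : LeafInsertion e ls ls') {last : Option ℕ} (hls : Threaded last ls)
    (hasc : Ascending (ls.flatMap Prod.fst)) (hasc' : Ascending (ls'.flatMap Prod.fst)) :
    ∀ l ∈ ls', PointsPast (ls.flatMap Prod.fst) last l ∨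
      PointsPast (ls'.flatMap Prod.fst) last l := by
  have hold := hls.pointsPast (pre := []) hasc
  obtain @⟨as, bs, new, es, q, -, -, -, hnew⟩ := h
  rw [List.forall_mem_append]
  refine ⟨fun l hl => .inl (hold l (by simp [hl])), fun l hl => .inr ?_⟩
  rw [threaded_append, Threaded] at hls
  have hthr : Threaded last (new ++ bs) := threaded_append.2 ⟨hls.2.1 ▸ hnew, hls.2.2⟩
  rw [List.flatMap_append] at hasc' ⊢
  exact hthr.pointsPast hasc' l hl

theorem DTree.leaves_ne_nil {p : Params} (hB : 3 ≤ p.B) {d : DTree K V}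
    (h : DNode.WellFormed p d.height true d.root) (hne : d.entries ≠ []) :
    ∀ l ∈ d.leaves, l.1 ≠ [] := by
  rcases d with ⟨_ | n, t⟩
  · simpa [DTree.leaves, DTree.entries, DNode.leaves, DNode.entries] using hne
  · exact h.leaves_ne_nil_of_pos hB

theorem DTree.WellFormed.insertS {p : Params} (hB : 3 ≤ p.B) (hB' : 2 ≤ p.B')
    {last last' : Option ℕ} {d : DTree K V} {e : Entry K V} {as bs : List (Entry K V)}
    (h : d.WellFormed p last) (hd : d.entries = as ++ bs) (has : ∀ y ∈ as, y.key < e.key)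
    (hbs : ∀ y ∈ bs, e.key < y.key) (he : e.ptr.isSome)
    (hlast : last' = last ∨ ∀ y ∈ bs, y.ptr = none) :
    (d.insertS p e (nextPtr bs last')).WellFormed p last' ∧
      (d.insertS p e (nextPtr bs last')).entries = as ++ e :: bs := by
  have he_notMem : e.key ∉ keySet d.entries := by
    simp only [hd, mem_keySet, not_exists, not_and, List.forall_mem_append]
    exact ⟨fun y hy => (has y hy).ne, fun y hy => (hbs y hy).ne'⟩
  obtain ⟨hroot, hins⟩ := DTree.insert_spec hB hB' h.root he_notMem
  have hnew : (d.insert p e).entries = as ++ e :: bs := by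
    rw [h.entries_insert hB hB' he_notMem, hd, insertSorted_append has hbs]
  have hpoints : ∀ l ∈ (d.insert p e).leaves,
      PointsPast (as ++ bs) last l ∨ PointsPast (as ++ e :: bs) last l := by
    rw [← hd, ← hnew]
    exact hins.forall_pointsPast h.threaded h.ascending hroot.ascending
  rw [DTree.insertS_eq h.ascending, hd]
  refine ⟨⟨hroot.mapPtr, ?_⟩, (DNode.entries_mapPtr ..).trans hnew⟩
  rw [DTree.leaves, DNode.leaves_mapPtr]
  have hflat (g : List (Entry K V) → Option ℕ → Option ℕ) :
      ((d.insert p e).leaves.map fun l => (l.1, g l.1 l.2)).flatMap Prod.fst = as ++ e :: bs := by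
    rw [List.flatMap_map]
    exact hnew
  refine threaded_of_forall_pointsPast (pre := []) ?_ ?_ ?_
  · rw [List.forall_mem_map]
    exact DTree.leaves_ne_nil hB hroot (by simp [hnew])
  · rw [List.nil_append]
    exact (hflat _).symm ▸ hnew ▸ hroot.ascending
  · rw [List.nil_append, List.forall_mem_map]
    intro l hl
    exact (hflat _).symm ▸ pointsPast_redirect he has hbs hlast (hpoints l hl)

theorem DTree.WellFormed.insertAll {p : Params} (hB : 3 ≤ p.B) (hB' : 2 ≤ p.B')
    {last : Option ℕ} {d : DTree K V} {es : List (Entry K V)}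
    (h : d.WellFormed p (nextPtr es last)) (hasc : Ascending (d.entries ++ es)) :
    (d.insertAll p last es).WellFormed p last ∧
      (d.insertAll p last es).entries = d.entries ++ es := by
  induction es generalizing d with
  | nil => simpa [DTree.insertAll] using h
  | cons e es ih =>
    have hlt : ∀ y ∈ d.entries, y.key < e.key :=
      fun y hy => (ascending_append.1 hasc).2.2 y hy e (by simp)
    rw [List.append_cons] at hasc ⊢
    rw [nextPtr_cons] at h
    rw [DTree.insertAll]
    split_ifs with he
    · rw [Option.or_of_isSome he] at h
      obtain ⟨hwf, hentries⟩ := h.insertS (last' := nextPtr es last) hB hB'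
        (List.append_nil _).symm hlt (by simp) he (.inr (by simp))
      rw [nextPtr_nil] at hwf hentries
      rw [← hentries] at hasc ⊢
      exact ih hwf hasc
    · have hptr : e.ptr = none := by simpa using he
      have he_notMem : e.key ∉ keySet d.entries := by simpa using fun y hy => (hlt y hy).ne
      have hentries := h.entries_insert hB hB' he_notMem
      rw [← List.append_nil d.entries, insertSorted_append hlt (by simp)] at hentries
      rw [hptr, Option.none_or] at h
      rw [← hentries] at hasc ⊢
      exact ih (h.insert hB hB' he_notMem hptr) hasc

theorem DTree.wellFormed_build {p : Params} (hB : 3 ≤ p.B) (hB' : 2 ≤ p.B')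
    {es : List (Entry K V)} (hes : Ascending es) (last : Option ℕ) :
    (DTree.build p last es).WellFormed p last ∧ (DTree.build p last es).entries = es :=
  (DTree.wellFormed_empty p _).insertAll hB hB' hes

end order

/-! ### s-nodes -/

theorem threaded_none_iff {ls : LeafList K V} (h : ∀ e ∈ ls.flatMap Prod.fst, e.ptr = none) :
    Threaded none ls ↔ ∀ l ∈ ls, l.2 = none := by
  induction ls with
  | nil => simp [Threaded]
  | cons l ls ih =>
    have hls : ∀ e ∈ ls.flatMap Prod.fst, e.ptr = none := fun e he => h e (by
      rw [List.flatMap_cons]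
      exact List.mem_append_right _ he)
    rw [Threaded, nextPtr_of_forall_none hls, ih hls, List.forall_mem_cons]

/-- The keys of the s-keys of a d-tree, which separate the children of its s-node. -/
def DTree.separators (d : DTree K V) : List K := (sKeys d.entries).map Entry.key

theorem DTree.length_separators (d : DTree K V) :
    d.separators.length = (sKeys d.entries).length :=
  List.length_map ..

theorem STree.addr_mem_addrs {n : ℕ} (t : STree K V n) : STree.addr n t ∈ STree.addrs n t := by
  cases n <;> simp [STree.addr, STree.addrs]

section order

variable [LinearOrder K] {p : Params} {n : ℕ}

/-- The d-tree `d` of a non-leaf s-node is well-formed, and with between `lo` and `hi` s-keys it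
links to the child s-nodes `cs`, each of which satisfies `Q`; `last` is the pointer to the last
child. -/
structure DTree.LinksTo (p : Params) (last : Option ℕ) (lo hi : ℕ) (Q : STree K V n → Prop)
    (d : DTree K V) (cs : List (STree K V n)) : Prop where
  wellFormed : d.WellFormed p last
  ptrs : (sKeys d.entries).map Entry.ptr ++ [last] = cs.map fun c => some (STree.addr n c)
  searchNode : IsSearchNode lo hi (fun c => keySet (STree.entries n c)) Q d.separators cs

/-- The requirements and properties (i) and (iii) for an s-node, which is the root if `isRoot`, and
for all s-nodes below it, except that a leaf root s-node may be empty. -/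
def STree.WellFormed (p : Params) : (n : ℕ) → (isRoot : Bool) → STree K V n → Prop
  | 0, isRoot, ⟨_, d⟩ => d.WellFormed p none ∧ (∀ e ∈ d.entries, e.ptr = none) ∧
      (if isRoot then 0 else p.s / 2) ≤ d.size ∧ d.size ≤ p.s
  | n + 1, isRoot, ⟨_, d, cs⟩ => d.size ≤ p.s ∧ ∃ last,
      d.LinksTo p last (if isRoot then 1 else (p.f - 1) / 2) (p.f - 1)
        (STree.WellFormed p n false) cs

variable {last : Option ℕ} {lo hi : ℕ} {Q : STree K V n → Prop} {d : DTree K V}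
  {cs : List (STree K V n)}

theorem DTree.LinksTo.last_eq (h : d.LinksTo p last lo hi Q cs) :
    last = cs.getLast?.map (STree.addr n) := by
  have hlast := congrArg List.getLast? h.ptrs
  rw [List.getLast?_concat, List.getLast?_map] at hlast
  cases hcs : cs.getLast? with
  | none => simp [hcs] at hlast
  | some c => simpa [hcs] using hlast

theorem DTree.separates_separators_iff (hl : cs.length = d.separators.length + 1) :
    Separates (fun c => keySet (STree.entries n c)) d.separators cs ↔
      d.separators.Pairwise (· < ·) ∧
      (∀ (i : ℕ) (e : Entry K V) (c : STree K V n), (sKeys d.entries)[i]? = some e →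
        cs[i]? = some c → ∀ x ∈ STree.entries n c, x.key ≤ e.key) ∧
      (∀ (i : ℕ) (e : Entry K V) (c : STree K V n), (sKeys d.entries)[i]? = some e →
        cs[i + 1]? = some c → ∀ x ∈ STree.entries n c, e.key < x.key) := by
  rw [separates_iff_getElem? hl]
  simp only [DTree.separators, List.getElem?_map, Option.map_eq_some_iff, forall_exists_index,
    and_imp, forall_mem_keySet]
  grind

theorem DTree.WellFormed.pairwise_separators (h : d.WellFormed p last) :
    d.separators.Pairwise (· < ·) :=
  ascending_iff_pairwise_map.1 (h.ascending.sublist List.filter_sublist)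

theorem DTree.linksTo_iff : (∃ last, d.LinksTo p last lo hi Q cs) ↔
    (d.SizeReq p ∧ d.IsBPlus ∧ Linked d cs) ∧ lo ≤ (sKeys d.entries).length ∧
      (sKeys d.entries).length ≤ hi ∧ ∀ c ∈ cs, Q c := by
  have hlen (h : (sKeys d.entries).map Entry.ptr ++ [cs.getLast?.map (STree.addr n)] =
      cs.map fun c => some (STree.addr n c)) : cs.length = d.separators.length + 1 := by
    simpa [DTree.length_separators, eq_comm] using congrArg List.length h
  constructor
  · rintro ⟨last, h⟩
    obtain rfl := h.last_eq
    obtain ⟨⟨hsize, hbp⟩, hthr⟩ := DTree.wellFormed_iff.1 h.wellFormed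
    obtain ⟨hlo, hhi, hl, hsep, hQ⟩ := h.searchNode
    rw [DTree.length_separators] at hlo hhi
    obtain ⟨-, hle, hlt⟩ := (DTree.separates_separators_iff hl).1 hsep
    exact ⟨⟨hsize, hbp, h.ptrs, hle, hlt, threaded_iff_getElem?.1 hthr⟩, hlo, hhi, hQ⟩
  · rintro ⟨⟨hsize, hbp, hptrs, hle, hlt, hthr⟩, hlo, hhi, hQ⟩
    have hwf : d.WellFormed p (cs.getLast?.map (STree.addr n)) :=
      DTree.wellFormed_iff.2 ⟨⟨hsize, hbp⟩, threaded_iff_getElem?.2 hthr⟩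
    refine ⟨_, hwf, hptrs, ?_, ?_, hlen hptrs, ?_, hQ⟩
    · rwa [DTree.length_separators]
    · rwa [DTree.length_separators]
    · exact (DTree.separates_separators_iff (hlen hptrs)).2 ⟨hwf.pairwise_separators, hle, hlt⟩

theorem DTree.wellFormed_none_iff (h : ∀ e ∈ d.entries, e.ptr = none) :
    d.WellFormed p none ↔ d.SizeReq p ∧ d.IsBPlus ∧ NoPointers d := by
  rw [DTree.wellFormed_iff, threaded_none_iff (ls := d.leaves) h, NoPointers, and_assoc]
  exact and_congr_right fun _ => and_congr_right fun _ => (and_iff_right h).symm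

theorem STree.WellFormed.of_requirements {isRoot : Bool} {t : STree K V n}
    (hsize : STree.SizeReq p n isRoot t) (hstruct : STree.StructReq p n isRoot t)
    (hbp : STree.AllBPlus n t) (hlink : STree.CrossLinked n t) :
    STree.WellFormed p n isRoot t := by
  induction n generalizing isRoot with
  | zero =>
    obtain ⟨a, d⟩ := t
    obtain ⟨hd, hlo, hhi⟩ := hsize
    refine ⟨(DTree.wellFormed_none_iff hlink.1).2 ⟨hd, hbp, hlink⟩, hlink.1, ?_, hhi⟩
    cases isRoot <;> simp_all
  | succ n ih =>
    obtain ⟨a, d, cs⟩ := t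
    obtain ⟨hd, -, hhi, hcs⟩ := hsize
    obtain ⟨-, -, hlo', hhi', hcs'⟩ := hstruct
    exact ⟨hhi, DTree.linksTo_iff.2 ⟨⟨hd, hbp.1, hlink.1⟩, hlo', hhi', fun c hc =>
      ih (hcs c hc) (hcs' c hc) (hbp.2 c hc) (hlink.2 c hc)⟩⟩

theorem STree.WellFormed.entries_ne_nil (hf : 3 ≤ p.f) (hs : 2 ≤ p.s) {t : STree K V n}
    (h : STree.WellFormed p n false t) : STree.entries n t ≠ [] := by
  cases n with
  | zero =>
    obtain ⟨a, d⟩ := t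
    have hlo : p.s / 2 ≤ d.size := h.2.2.1
    refine List.ne_nil_of_length_pos (lt_of_lt_of_le ?_ hlo)
    omega
  | succ n =>
    obtain ⟨a, d, cs⟩ := t
    obtain ⟨-, last, hlinks⟩ := h
    have hlo : (p.f - 1) / 2 ≤ d.separators.length := hlinks.searchNode.le_length
    have hsep : sKeys d.entries ≠ [] := by
      rw [DTree.length_separators] at hlo
      exact List.ne_nil_of_length_pos (by omega)
    obtain ⟨e, he⟩ := List.exists_mem_of_ne_nil _ hsep
    exact List.ne_nil_of_mem (List.mem_append_left _ (mem_sKeys.1 he).1)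

theorem STree.WellFormed.requirements (hf : 3 ≤ p.f) (hs : 2 ≤ p.s) {isRoot : Bool}
    {t : STree K V n} (h : STree.WellFormed p n isRoot t) (hne : STree.entries n t ≠ []) :
    STree.SizeReq p n isRoot t ∧ STree.StructReq p n isRoot t ∧ STree.AllBPlus n t ∧
      STree.CrossLinked n t := by
  induction n generalizing isRoot with
  | zero =>
    obtain ⟨a, d⟩ := t
    obtain ⟨hwf, hnone, hlo, hhi⟩ := h
    obtain ⟨hsize, hbp, hnp⟩ := (DTree.wellFormed_none_iff hnone).1 hwf
    refine ⟨⟨hsize, ?_, hhi⟩, trivial, hbp, hnp⟩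
    cases isRoot
    · exact hlo
    · exact List.length_pos_iff.2 hne
  | succ n ih =>
    obtain ⟨a, d, cs⟩ := t
    obtain ⟨hsize, last, hlinks⟩ := h
    have hl := hlinks.searchNode.length_kids
    obtain ⟨⟨hd, hbp, hlinked⟩, hlo, hhi, hcs⟩ := DTree.linksTo_iff.1 ⟨last, hlinks⟩
    have hkids c hc := ih (hcs c hc) (STree.WellFormed.entries_ne_nil hf hs (hcs c hc))
    have hle : (sKeys d.entries).length ≤ d.size := List.length_filter_le ..
    rw [DTree.length_separators] at hl
    refine ⟨⟨hd, ?_, hsize, fun c hc => (hkids c hc).1⟩,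
      ⟨?_, ?_, hlo, hhi, fun c hc => (hkids c hc).2.1⟩,
      ⟨hbp, fun c hc => (hkids c hc).2.2.1⟩, hlinked, fun c hc => (hkids c hc).2.2.2⟩
    · split_ifs at hlo <;> omega
    · split_ifs at hlo ⊢ <;> omega
    · omega

end order

/-! ### The effect of an insertion below an s-node -/

/-- The stored key-value pairs; a multiset, since merges and splits move pairs between s-nodes. -/
def pairsOf (es : List (Entry K V)) : Multiset (K × V) := ↑(es.map fun e => (e.key, e.val))

@[simp] theorem pairsOf_nil : pairsOf ([] : List (Entry K V)) = 0 := rfl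

@[simp] theorem pairsOf_cons (e : Entry K V) (es : List (Entry K V)) :
    pairsOf (e :: es) = {(e.key, e.val)} + pairsOf es := rfl

@[simp] theorem pairsOf_append (as bs : List (Entry K V)) :
    pairsOf (as ++ bs) = pairsOf as + pairsOf bs := by
  simp [pairsOf]

theorem pairsOf_sKeys_add_rKeys (es : List (Entry K V)) :
    pairsOf (sKeys es) + pairsOf (rKeys es) = pairsOf es := by
  rw [← pairsOf_append]
  exact Multiset.coe_eq_coe.2 ((sKeys_append_rKeys_perm es).map _)

theorem keySet_subset_of_pairsOf_le {as bs : List (Entry K V)} (h : pairsOf as ≤ pairsOf bs) :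
    keySet as ⊆ keySet bs := by
  rintro _ ⟨x, hx, rfl⟩
  have hx' : (x.key, x.val) ∈ pairsOf bs :=
    Multiset.mem_of_le h (Multiset.mem_coe.2 (List.mem_map.2 ⟨x, hx, rfl⟩))
  obtain ⟨y, hy, hyx⟩ := List.mem_map.1 (Multiset.mem_coe.1 hx')
  exact ⟨y, hy, congrArg Prod.fst hyx⟩

theorem keySet_subset_insert {e : Entry K V} {as bs : List (Entry K V)}
    (h : pairsOf as ≤ pairsOf bs + {(e.key, e.val)}) :
    keySet as ⊆ insert e.key (keySet bs) := by
  have hcons : keySet (e :: bs) = insert e.key (keySet bs) := by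
    ext k
    simp [eq_comm]
  rw [← hcons]
  exact keySet_subset_of_pairsOf_le (by rwa [pairsOf_cons, add_comm])

/-- `L'` consists of `L` and of distinct new addresses among `a, …, a + m - 1`. -/
def AddrsExtend (a m : ℕ) (L L' : Multiset ℕ) : Prop :=
  ∃ N : Multiset ℕ, L' = L + N ∧ N.Nodup ∧ ∀ x ∈ N, a ≤ x ∧ x < a + m

theorem AddrsExtend.refl (a m : ℕ) (L : Multiset ℕ) : AddrsExtend a m L L :=
  ⟨0, by simp⟩

theorem AddrsExtend.mono {a m m' : ℕ} {L L' : Multiset ℕ} (h : AddrsExtend a m L L')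
    (hm : m ≤ m') : AddrsExtend a m' L L' := by
  obtain ⟨N, hL, hN, hbd⟩ := h
  exact ⟨N, hL, hN, fun x hx => ⟨(hbd x hx).1, (hbd x hx).2.trans_le (by omega)⟩⟩

theorem AddrsExtend.add_right {a m : ℕ} {L L' : Multiset ℕ} (h : AddrsExtend a m L L')
    (M : Multiset ℕ) : AddrsExtend a m (L + M) (L' + M) := by
  obtain ⟨N, rfl, hN⟩ := h
  exact ⟨N, add_right_comm L N M, hN⟩

theorem AddrsExtend.add_fresh {a m : ℕ} {L L' : Multiset ℕ} (h : AddrsExtend a m L L') :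
    AddrsExtend a (m + 1) L (L' + {a + m}) := by
  obtain ⟨N, rfl, hN, hbd⟩ := h
  refine ⟨(a + m) ::ₘ N, ?_, Multiset.nodup_cons.2 ⟨fun hmem => ?_, hN⟩, ?_⟩
  · rw [← Multiset.singleton_add, add_assoc, add_comm N]
  · exact lt_irrefl _ (hbd _ hmem).2
  · rw [Multiset.forall_mem_cons]
    exact ⟨by omega, fun x hx => ⟨(hbd x hx).1, Nat.lt_succ_of_lt (hbd x hx).2⟩⟩

theorem AddrsExtend.nodup {a m : ℕ} {L L' : Multiset ℕ} (h : AddrsExtend a m L L')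
    (hL : L.Nodup) (hlt : ∀ x ∈ L, x < a) : L'.Nodup := by
  obtain ⟨N, rfl, hN, hbd⟩ := h
  refine Multiset.nodup_add.2 ⟨hL, hN, Multiset.disjoint_left.2 fun hx hx' => ?_⟩
  exact absurd (hbd _ hx').1 (not_le.2 (hlt _ hx))

theorem AddrsExtend.lt {a m : ℕ} {L L' : Multiset ℕ} (h : AddrsExtend a m L L')
    (hlt : ∀ x ∈ L, x < a) : ∀ x ∈ L', x < a + m := by
  obtain ⟨N, rfl, -, hbd⟩ := h
  intro x hx
  rcases Multiset.mem_add.1 hx with hx | hx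
  · exact (hlt x hx).trans_le (Nat.le_add_right a m)
  · exact (hbd x hx).2

theorem STree.pairsOf_entries_succ {n a : ℕ} {d : DTree K V} {cl cr : List (STree K V n)} :
    pairsOf (STree.entries (n + 1) ⟨a, d, cl ++ cr⟩) =
      pairsOf d.entries + (pairsOf (cl.flatMap fun c => STree.entries n c) +
        pairsOf (cr.flatMap fun c => STree.entries n c)) := by
  simp [STree.entries]

theorem STree.coe_addrs_succ {n a : ℕ} {d : DTree K V} {cl cr : List (STree K V n)} :
    (STree.addrs (n + 1) ⟨a, d, cl ++ cr⟩ : Multiset ℕ) =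
      {a} + (↑(cl.flatMap fun c => STree.addrs n c) +
        ↑(cr.flatMap fun c => STree.addrs n c)) := by
  simp [STree.addrs]

/-- The address of the s-node, or of the upper one of two: it is that of the s-node into which the
insertion took place. -/
def SRes.addr {n : ℕ} : SRes K V n → ℕ
  | .one t => STree.addr n t
  | .two _ _ _ r => STree.addr n r

/-- All addresses below the outcome of an insertion. -/
def SRes.addrs {n : ℕ} : SRes K V n → Multiset ℕ
  | .one t => STree.addrs n t
  | .two l _ _ r => ↑(STree.addrs n l) + ↑(STree.addrs n r)

/-- All pairs below the outcome of an insertion, including the promoted median. -/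
def SRes.pairs {n : ℕ} : SRes K V n → Multiset (K × V)
  | .one t => pairsOf (STree.entries n t)
  | .two l k x r => pairsOf (STree.entries n l) + {(k, x)} + pairsOf (STree.entries n r)

section order

variable [LinearOrder K] {p : Params} {n a h : ℕ} {y : K}

/-- On the search path of `y`, the s-nodes at heights greater than `h` contain only s-keys. -/
def OnlySKeysAbove (h : ℕ) (y : K) : (n : ℕ) → STree K V n → Prop
  | 0, _ => True
  | n + 1, ⟨_, d, cs⟩ => h < n + 1 → (∀ e ∈ d.entries, e.ptr.isSome) ∧
      ∀ c ∈ searchChild y d.separators cs, OnlySKeysAbove h y n c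

theorem onlySKeysAbove_of_le {t : STree K V n} (hn : n ≤ h) : OnlySKeysAbove h y n t := by
  cases n with
  | zero => trivial
  | succ n => exact fun hlt => absurd hn (not_le.2 hlt)

/-- `OnlySKeysAbove` for the outcome of an insertion, where the search for `y` goes to the piece on
the side of `y`. -/
def SRes.OnlySKeysAbove (h : ℕ) (y : K) {n : ℕ} : SRes K V n → Prop
  | .one t => NBT.OnlySKeysAbove h y n t
  | .two l k _ r => (y ≤ k → NBT.OnlySKeysAbove h y n l) ∧ (k < y → NBT.OnlySKeysAbove h y n r)

theorem SRes.onlySKeysAbove_of_le {res : SRes K V n} (hn : n ≤ h) : res.OnlySKeysAbove h y := by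
  cases res with
  | one t => exact NBT.onlySKeysAbove_of_le hn
  | two l k x r =>
    exact ⟨fun _ => NBT.onlySKeysAbove_of_le hn, fun _ => NBT.onlySKeysAbove_of_le hn⟩

/-- `STree.WellFormed` for the outcome of an insertion, of which two pieces are not the root and
are separated by the promoted median. -/
def SRes.WellFormed (p : Params) (isRoot : Bool) {n : ℕ} : SRes K V n → Prop
  | .one t => STree.WellFormed p n isRoot t
  | .two l k _ r => STree.WellFormed p n false l ∧ STree.WellFormed p n false r ∧
      (∀ x ∈ STree.entries n l, x.key ≤ k) ∧ ∀ x ∈ STree.entries n r, k < x.key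

/-- The s-node `t` is replaced by `res` without changing the stored pairs, at the expense of the
address `a`. -/
structure STree.SplitEffect (a : ℕ) (t : STree K V n) (res : SRes K V n) : Prop where
  addr : res.addr = STree.addr n t
  pairs : res.pairs = pairsOf (STree.entries n t)
  addrs : res.addrs = ↑(STree.addrs n t) + {a}
  path : ∀ h y, NBT.OnlySKeysAbove h y n t → res.OnlySKeysAbove h y

/-- The outcome `r` of an insertion of `e` at height `h` below the s-node `t`: the s-nodes that
replace `t`, which use new addresses among `a, …, a + m - 1`, and the r-keys that a merge returns
for insertion at height `h - 1`.  Search paths that contain only s-keys above some height remain so;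
this keeps the s-nodes above a merged one free for the s-keys promoted to them. -/
structure STree.InsertEffect (a m h : ℕ) (e : Entry K V) (t : STree K V n)
    (r : SRes K V n × List (Entry K V)) : Prop where
  addr : r.1.addr = STree.addr n t
  pairs : r.1.pairs + pairsOf r.2 = pairsOf (STree.entries n t) + {(e.key, e.val)}
  addrs : AddrsExtend a m (STree.addrs n t) r.1.addrs
  path : ∀ h' y, h ≤ h' → NBT.OnlySKeysAbove h' y n t → r.1.OnlySKeysAbove h' y
  flushed : ∀ x ∈ r.2, x.ptr = none ∧ 1 ≤ h ∧
    ∃ t', r.1 = .one t' ∧ NBT.OnlySKeysAbove (h - 1) x.key n t'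

variable {m : ℕ} {e : Entry K V}

theorem STree.InsertEffect.mono {m' : ℕ} {t : STree K V n} {r : SRes K V n × List (Entry K V)}
    (heff : STree.InsertEffect a m h e t r) (hm : m ≤ m') : STree.InsertEffect a m' h e t r :=
  { heff with addrs := heff.addrs.mono hm }

theorem STree.InsertEffect.split {t t₁ : STree K V n} {res : SRes K V n}
    (h₁ : STree.InsertEffect a m h e t (.one t₁, []))
    (h₂ : STree.SplitEffect (a + m) t₁ res) :
    STree.InsertEffect a (m + 1) h e t (res, []) where
  addr := h₂.addr.trans h₁.addr
  pairs := (congrArg (· + pairsOf []) h₂.pairs).trans h₁.pairs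
  addrs := h₂.addrs ▸ h₁.addrs.add_fresh
  path h' y hle hpath := h₂.path h' y (h₁.path h' y hle hpath)
  flushed := by simp

theorem pairsOf_insertSorted (e : Entry K V) (es : List (Entry K V)) :
    pairsOf (insertSorted e es) = pairsOf es + {(e.key, e.val)} := by
  rw [add_comm, ← pairsOf_cons]
  exact Multiset.coe_eq_coe.2 ((insertSorted_perm e es).map _)

end order

theorem nextPtr_eq_of_map_ptr {n : ℕ} {d : DTree K V} {last : Option ℕ} {c : STree K V n}
    {cs : List (STree K V n)} {as bs : List (Entry K V)}
    (hs : sKeys d.entries = as ++ bs)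
    (hptrs : bs.map Entry.ptr ++ [last] = (c :: cs).map fun c => some (STree.addr n c)) :
    nextPtr bs last = some (STree.addr n c) := by
  have hsome : ∀ x ∈ bs, x.ptr.isSome := fun x hx =>
    (mem_sKeys.1 (hs ▸ List.mem_append_right as hx)).2
  have hhead := head?_map_ptr_append hsome last
  rw [hptrs] at hhead
  exact (Option.some.inj hhead).symm

section order

variable [LinearOrder K] {p : Params} {n a m h addr : ℕ} {e : Entry K V} {isRoot : Bool}

/-! ### Insertion into a leaf s-node -/

theorem splitLeaf_eq {d : DTree K V} {as bs : List (Entry K V)} {x : Entry K V}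
    (hd : d.entries = as ++ x :: bs) (hm : as.length = d.entries.length / 2) :
    splitLeaf p a addr d =
      .two ⟨a, DTree.build p none as⟩ x.key x.val ⟨addr, DTree.build p none bs⟩ := by
  simp only [splitLeaf, ← hm]
  simp [hd]

theorem STree.wellFormed_build (hB : 3 ≤ p.B) (hB' : 2 ≤ p.B') {es : List (Entry K V)}
    (hes : Ascending es) (hnone : ∀ e ∈ es, e.ptr = none) (hlo : p.s / 2 ≤ es.length)
    (hhi : es.length ≤ p.s) : STree.WellFormed p 0 false ⟨addr, DTree.build p none es⟩ := by
  obtain ⟨hwf, hentries⟩ := DTree.wellFormed_build hB hB' hes none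
  refine ⟨hwf, ?_⟩
  rw [DTree.size, hentries]
  exact ⟨hnone, hlo, hhi⟩

theorem splitLeaf_spec (hB : 3 ≤ p.B) (hB' : 2 ≤ p.B') {d : DTree K V} (hd : d.WellFormed p none)
    (hnone : ∀ e ∈ d.entries, e.ptr = none) (hsize : d.size = p.s + 1) :
    (splitLeaf p a addr d).WellFormed p isRoot ∧
      STree.SplitEffect (n := 0) a ⟨addr, d⟩ (splitLeaf p a addr d) := by
  rw [DTree.size] at hsize
  obtain ⟨as, x, bs, hes, hm⟩ := exists_eq_append_cons_of_lt (l := d.entries)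
    (i := d.entries.length / 2) (by omega)
  have hlen : d.entries.length = as.length + (bs.length + 1) := by simp [hes]
  have hasc := hd.ascending
  rw [hes, ascending_append] at hasc
  obtain ⟨has, hxbs, hcross⟩ := hasc
  obtain ⟨hx, hbs⟩ := List.pairwise_cons.1 hxbs
  have hel := (DTree.wellFormed_build (p := p) hB hB' has none).2
  have her := (DTree.wellFormed_build (p := p) hB hB' hbs none).2
  rw [splitLeaf_eq hes hm]
  constructor
  · refine ⟨STree.wellFormed_build hB hB' has (fun e he => hnone e ?_) (by omega) (by omega),
      STree.wellFormed_build hB hB' hbs (fun e he => hnone e ?_) (by omega) (by omega),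
      fun y hy => (hcross y (hel ▸ hy) x (by simp)).le, fun y hy => hx y (her ▸ hy)⟩
    all_goals simp [hes, he]
  · refine ⟨rfl, ?_, ?_, fun h y _ => SRes.onlySKeysAbove_of_le (Nat.zero_le h)⟩
    · simp [SRes.pairs, STree.entries, hel, her, hes, add_assoc]
    · simp [SRes.addrs, STree.addrs, add_comm]

theorem DTree.WellFormed.pairsOf_insert (hB : 3 ≤ p.B) (hB' : 2 ≤ p.B') {last : Option ℕ}
    {d : DTree K V} (hd : d.WellFormed p last) (he : e.key ∉ keySet d.entries) :
    pairsOf (d.insert p e).entries = pairsOf d.entries + {(e.key, e.val)} := by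
  rw [hd.entries_insert hB hB' he, pairsOf_insertSorted]

theorem DTree.WellFormed.size_insert (hB : 3 ≤ p.B) (hB' : 2 ≤ p.B') {last : Option ℕ}
    {d : DTree K V} (hd : d.WellFormed p last) (he : e.key ∉ keySet d.entries) :
    (d.insert p e).size = d.size + 1 := by
  rw [DTree.size, hd.entries_insert hB hB' he, length_insertSorted, DTree.size]

theorem STree.insertAt_zero (hB : 3 ≤ p.B) (hB' : 2 ≤ p.B') {t : STree K V 0}
    (ht : STree.WellFormed p 0 isRoot t) (hptr : e.ptr = none)
    (he : e.key ∉ keySet (STree.entries 0 t)) :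
    (STree.insertAt p a h e 0 t).1.WellFormed p isRoot ∧
      STree.InsertEffect a 1 h e t (STree.insertAt p a h e 0 t) := by
  obtain ⟨addr, d⟩ := t
  obtain ⟨hd, hnone, hlo, hhi⟩ := ht
  have hwf := hd.insert hB hB' he hptr
  have hsize := hd.size_insert hB hB' he
  have hnone' : ∀ x ∈ (d.insert p e).entries, x.ptr = none := by
    rw [hd.entries_insert hB hB' he]
    intro x hx
    rcases mem_insertSorted.1 hx with rfl | hx
    · exact hptr
    · exact hnone x hx
  have heff : STree.InsertEffect (n := 0) a 0 h e ⟨addr, d⟩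
      (.one ⟨addr, d.insert p e⟩, []) :=
    { addr := rfl
      pairs := by simpa [SRes.pairs, STree.entries] using hd.pairsOf_insert hB hB' he
      addrs := AddrsExtend.refl a 0 _
      path := fun h' y _ _ => SRes.onlySKeysAbove_of_le (Nat.zero_le h')
      flushed := by simp }
  simp only [STree.insertAt]
  split_ifs with hle
  · exact ⟨⟨hwf, hnone', hlo.trans (by omega), hle⟩, heff.mono (Nat.zero_le 1)⟩
  · obtain ⟨hwf', hsplit⟩ := splitLeaf_spec (a := a) (addr := addr) (isRoot := isRoot) hB hB' hwf
      hnone' (by omega)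
    exact ⟨hwf', heff.split hsplit⟩

/-! ### Insertion into the d-tree of a non-leaf s-node -/

variable {last : Option ℕ} {lo hi : ℕ} {Q : STree K V n → Prop} {d : DTree K V}
  {cs cl cr : List (STree K V n)} {c c' : STree K V n} {y : K}

theorem DTree.LinksTo.of_sKeys_eq {d' : DTree K V} (hd : d.LinksTo p last lo hi Q cs)
    (hd' : d'.WellFormed p last) (hs : sKeys d'.entries = sKeys d.entries) :
    d'.LinksTo p last lo hi Q cs where
  wellFormed := hd'
  ptrs := hs ▸ hd.ptrs
  searchNode := by
    rw [DTree.separators, hs]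
    exact hd.searchNode

theorem DTree.LinksTo.insert (hB : 3 ≤ p.B) (hB' : 2 ≤ p.B') (hd : d.LinksTo p last lo hi Q cs)
    (he : e.key ∉ keySet d.entries) (hptr : e.ptr = none) :
    (d.insert p e).LinksTo p last lo hi Q cs :=
  hd.of_sKeys_eq (hd.wellFormed.insert hB hB' he hptr)
    (by rw [hd.wellFormed.entries_insert hB hB' he, sKeys_insertSorted hptr])

theorem DTree.linksTo_build (hB : 3 ≤ p.B) (hB' : 2 ≤ p.B') {es : List (Entry K V)}
    (hes : Ascending es) (hall : ∀ x ∈ es, x.ptr.isSome)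
    (hptrs : es.map Entry.ptr ++ [last] = cs.map fun c => some (STree.addr n c))
    (hnode : IsSearchNode lo hi (fun c => keySet (STree.entries n c)) Q (es.map Entry.key) cs) :
    (DTree.build p last es).LinksTo p last lo hi Q cs := by
  obtain ⟨hwf, hentries⟩ := DTree.wellFormed_build (p := p) hB hB' hes last
  have hsKeys : sKeys (DTree.build p last es).entries = es := by rw [hentries, sKeys_eq_self hall]
  refine ⟨hwf, hsKeys.symm ▸ hptrs, ?_⟩
  rwa [DTree.separators, hsKeys]

theorem DTree.LinksTo.replace {kl kr : List K} (hd : d.LinksTo p last lo hi Q (cl ++ c :: cr))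
    (hsep : d.separators = kl ++ kr) (hpos : IsSearchPos y kl kr cl cr)
    (haddr : STree.addr n c' = STree.addr n c)
    (hkeys : keySet (STree.entries n c') ⊆ Insert.insert y (keySet (STree.entries n c)))
    (hQ : Q c') :
    d.LinksTo p last lo hi Q (cl ++ c' :: cr) where
  wellFormed := hd.wellFormed
  ptrs := by simpa [haddr] using hd.ptrs
  searchNode := by
    have hnode := hd.searchNode
    rw [hsep] at hnode ⊢
    exact hnode.replace hpos hkeys hQ

theorem DTree.LinksTo.exists_sKeys_eq_append {kl kr : List K}
    (hd : d.LinksTo p last lo hi Q (cl ++ cr)) (hsep : d.separators = kl ++ kr)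
    (hl : kl.length = cl.length) :
    ∃ as bs, sKeys d.entries = as ++ bs ∧ as.map Entry.key = kl ∧ bs.map Entry.key = kr ∧
      as.map Entry.ptr = (cl.map fun c => some (STree.addr n c)) ∧
      bs.map Entry.ptr ++ [last] = cr.map fun c => some (STree.addr n c) := by
  obtain ⟨as, bs, hs, has, hbs⟩ := List.map_eq_append_iff.1 hsep
  have hptrs := hd.ptrs
  rw [hs, List.map_append, List.append_assoc, List.map_append] at hptrs
  have hlen : as.length = cl.length := by rw [← hl, ← has, List.length_map]
  obtain ⟨hcl, hcr⟩ := List.append_inj hptrs (by simpa using hlen)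
  exact ⟨as, bs, hs, has, hbs, hcl, hcr⟩

theorem DTree.LinksTo.route_eq {kl kr : List K} (hd : d.LinksTo p last lo hi Q (cl ++ c :: cr))
    (hsep : d.separators = kl ++ kr) (hpos : IsSearchPos y kl kr cl cr)
    (hy : y ∉ keySet d.entries) : d.route y = some (STree.addr n c) := by
  obtain ⟨as, bs, hs, rfl, rfl, -, hptrs⟩ := hd.exists_sKeys_eq_append hsep hpos.length_left
  have hleft : as.filter (fun x : Entry K V => y < x.key) = [] := by
    simpa using fun x hx => (hpos.lt _ (List.mem_map_of_mem hx)).le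
  have hright : bs.filter (fun x : Entry K V => y < x.key) = bs := by
    rw [List.filter_eq_self]
    intro x hx
    have hxd : x ∈ d.entries := (mem_sKeys.1 (hs ▸ List.mem_append_right as hx)).1
    have hne : y ≠ x.key := fun hyx => hy ⟨x, hxd, hyx.symm⟩
    exact decide_eq_true ((hpos.le x.key (List.mem_map_of_mem hx)).lt_of_ne hne)
  rw [DTree.route, hs, List.filter_append, hleft, hright, List.nil_append,
    hd.wellFormed.lastPtr_eq]
  exact nextPtr_eq_of_map_ptr hs hptrs

theorem DTree.LinksTo.findIdx_route {kl kr : List K}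
    (hd : d.LinksTo p last lo hi Q (cl ++ c :: cr)) (hsep : d.separators = kl ++ kr)
    (hpos : IsSearchPos y kl kr cl cr) (hy : y ∉ keySet d.entries)
    (hnodup : ((cl ++ c :: cr).flatMap fun c => STree.addrs n c).Nodup) :
    ((cl ++ c :: cr).findIdx fun c => d.route y = some (STree.addr n c)) = cl.length := by
  rw [hd.route_eq hsep hpos hy]
  rw [List.flatMap_append, List.nodup_append'] at hnodup
  have hcl : ∀ z ∈ cl, STree.addr n c ≠ STree.addr n z := by
    intro z hz hzc
    refine List.disjoint_left.1 hnodup.2.2 (List.mem_flatMap.2 ⟨z, hz, z.addr_mem_addrs⟩) ?_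
    rw [← hzc]
    exact List.mem_flatMap.2 ⟨c, by simp, c.addr_mem_addrs⟩
  rw [List.findIdx_append, List.findIdx_eq_length_of_false (by simpa using hcl)]
  simp [List.findIdx_cons]

theorem DTree.LinksTo.insertS (hB : 3 ≤ p.B) (hB' : 2 ≤ p.B') {kl kr : List K}
    {l r : STree K V n} {hi' : ℕ} (hd : d.LinksTo p last lo hi Q (cl ++ c :: cr))
    (hall : ∀ z ∈ d.entries, z.ptr.isSome) (hsep : d.separators = kl ++ kr)
    (hl : kl.length = cl.length) (hptr : e.ptr = some (STree.addr n l))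
    (haddr : STree.addr n r = STree.addr n c)
    (hnode : IsSearchNode lo hi' (fun c => keySet (STree.entries n c)) Q (kl ++ e.key :: kr)
      (cl ++ l :: r :: cr)) :
    (d.insertS p e (some (STree.addr n r))).LinksTo p last lo hi' Q (cl ++ l :: r :: cr) ∧
      (d.insertS p e (some (STree.addr n r))).separators = kl ++ e.key :: kr ∧
      pairsOf (d.insertS p e (some (STree.addr n r))).entries =
        pairsOf d.entries + {(e.key, e.val)} ∧
      ∀ z ∈ (d.insertS p e (some (STree.addr n r))).entries, z.ptr.isSome := by
  obtain ⟨as, bs, hs, rfl, rfl, hcl, hcr⟩ := hd.exists_sKeys_eq_append hsep hl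
  have hnext : nextPtr bs last = some (STree.addr n r) :=
    haddr ▸ nextPtr_eq_of_map_ptr hs hcr
  rw [sKeys_eq_self hall] at hs
  have hpw := List.pairwise_append.1 hnode.separates.pairwise
  have has : ∀ y ∈ as, y.key < e.key := fun y hy =>
    hpw.2.2 _ (List.mem_map_of_mem hy) e.key (by simp)
  have hbs : ∀ y ∈ bs, e.key < y.key := fun y hy =>
    (List.pairwise_cons.1 hpw.2.1).1 _ (List.mem_map_of_mem hy)
  have hsome : e.ptr.isSome := by simp [hptr]
  obtain ⟨hwf, hentries⟩ := hd.wellFormed.insertS hB hB' hs has hbs hsome (.inl rfl)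
  rw [hnext] at hwf hentries
  have hall' : ∀ z ∈ as ++ e :: bs, z.ptr.isSome := by
    rw [hs] at hall
    simp_all [or_imp, forall_and]
  have hsep' : (d.insertS p e (some (STree.addr n r))).separators =
      as.map Entry.key ++ e.key :: bs.map Entry.key := by
    rw [DTree.separators, hentries, sKeys_eq_self hall']
    simp
  refine ⟨⟨hwf, ?_, hsep' ▸ hnode⟩, hsep', ?_, hentries ▸ hall'⟩
  · rw [List.map_cons] at hcr
    rw [hentries, sKeys_eq_self hall']
    simp [hcl, hcr, hptr, haddr]
  · rw [hentries, hs]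
    simp only [pairsOf_append, pairsOf_cons]
    abel

end order

theorem DTree.separators_eq {d : DTree K V} {es : List (Entry K V)}
    (hall : ∀ z ∈ d.entries, z.ptr.isSome) (hes : d.entries = es) :
    d.separators = es.map Entry.key := by
  rw [DTree.separators, sKeys_eq_self hall, hes]

section order

variable [LinearOrder K] {p : Params} {n a m h addr : ℕ} {e : Entry K V} {isRoot : Bool}

/-! ### Insertion into a non-leaf s-node -/

variable {last : Option ℕ} {lo hi : ℕ} {Q : STree K V n → Prop} {d : DTree K V}
  {cs cl cr : List (STree K V n)} {c c' : STree K V n}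

theorem DTree.LinksTo.exists_median (hB : 3 ≤ p.B) (hB' : 2 ≤ p.B')
    (hd : d.LinksTo p last lo (hi + 1) Q cs) (hall : ∀ z ∈ d.entries, z.ptr.isSome)
    (hlen : hi < d.separators.length) :
    ∃ as x bs cl c cr, d.entries = as ++ x :: bs ∧ cs = cl ++ c :: cr ∧
      as.length = d.entries.length / 2 ∧ as.length = cl.length ∧
      (DTree.build p x.ptr as).LinksTo p x.ptr (hi / 2) hi Q (cl ++ [c]) ∧
      (DTree.build p last bs).LinksTo p last (hi / 2) hi Q cr := by
  obtain ⟨kl, k, kr, cl, c, cr, hks, rfl, hm, hl⟩ :=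
    hd.searchNode.exists_median (List.ne_nil_of_length_pos (by omega))
  have hnode := hks ▸ hd.searchNode
  have hmid := hks ▸ hm
  obtain ⟨as, xbs, hes, rfl, hkeys, hcl, hcr⟩ := hd.exists_sKeys_eq_append hks hl
  obtain ⟨x, bs, rfl, rfl, rfl⟩ := List.map_eq_cons_iff.1 hkeys
  obtain ⟨hx, hbs⟩ := List.cons.inj hcr
  rw [DTree.length_separators, sKeys_eq_self hall, List.length_map] at hm
  rw [sKeys_eq_self hall] at hes
  have hasc := hd.wellFormed.ascending
  rw [hes, ascending_append] at hasc
  simp only [hes, List.forall_mem_append, List.forall_mem_cons] at hall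
  rw [hks] at hlen
  refine ⟨as, x, bs, cl, c, cr, hes, rfl, hm, by simpa using hl,
    DTree.linksTo_build hB hB' hasc.1 hall.1 ?_ (hnode.left hl hlen hmid),
    DTree.linksTo_build hB hB' (List.pairwise_cons.1 hasc.2.1).2 hall.2.2 hbs
      (hnode.right hl hlen hmid)⟩
  simp [hcl, hx]

theorem splitNode_eq {as bs : List (Entry K V)} {x : Entry K V} (hd : d.WellFormed p last)
    (hall : ∀ z ∈ d.entries, z.ptr.isSome) (hes : d.entries = as ++ x :: bs)
    (hm : as.length = d.entries.length / 2) (hl : as.length = cl.length) :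
    splitNode p a addr d (cl ++ c :: cr) =
      .two ⟨a, DTree.build p x.ptr as, cl ++ [c]⟩ x.key x.val
        ⟨addr, DTree.build p last bs, cr⟩ := by
  have hasc := hes ▸ hd.ascending
  simp only [splitNode, sKeys_eq_self hall, ← hm, hd.lastPtr_eq]
  simp only [hes, List.getElem?_append_right le_rfl, Nat.sub_self, List.getElem?_cons_zero,
    hasc.filter_key_lt, hasc.filter_lt_key]
  simp [hl, List.take_append]

theorem STree.WellFormed.of_linksTo (hfs : p.f ≤ p.s) (hall : ∀ z ∈ d.entries, z.ptr.isSome)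
    (hd : d.LinksTo p last lo (p.f - 1) (STree.WellFormed p n false) cs)
    (hlo : (if isRoot then 1 else (p.f - 1) / 2) ≤ lo) :
    STree.WellFormed p (n + 1) isRoot ⟨addr, d, cs⟩ := by
  have hlen := hd.searchNode.length_le
  rw [DTree.separators_eq hall rfl, List.length_map] at hlen
  exact ⟨hlen.trans (by omega), last, hd.wellFormed, hd.ptrs,
    { hd.searchNode with le_length := hlo.trans hd.searchNode.le_length }⟩

section split

variable {d₁ d₂ : DTree K V} {as bs : List (Entry K V)} {x : Entry K V}

theorem STree.entries_le_and_lt_of_split (hasc : Ascending (as ++ x :: bs))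
    (hkeys : Separates (fun c => keySet (STree.entries n c))
      (as.map Entry.key ++ x.key :: bs.map Entry.key) (cl ++ c :: cr))
    (hl : as.length = cl.length) (h₁ : d₁.entries = as) (h₂ : d₂.entries = bs) :
    (∀ y ∈ STree.entries (n + 1) ⟨a, d₁, cl ++ [c]⟩, y.key ≤ x.key) ∧
      ∀ y ∈ STree.entries (n + 1) ⟨addr, d₂, cr⟩, x.key < y.key := by
  obtain ⟨-, hxbs, hcross⟩ := ascending_append.1 hasc
  have hlmap : (as.map Entry.key).length = cl.length := by rwa [List.length_map]
  simp only [STree.entries, h₁, h₂, List.forall_mem_append, List.mem_flatMap]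
  refine ⟨⟨fun y hy => (hcross y hy x (by simp)).le, ?_⟩, (List.pairwise_cons.1 hxbs).1, ?_⟩
  · rintro y ⟨c', hc', hy⟩
    exact hkeys.le_of_mem_left hlmap hc' ⟨y, hy, rfl⟩
  · rintro y ⟨c', hc', hy⟩
    exact hkeys.lt_of_mem_drop hlmap hc' ⟨y, hy, rfl⟩

theorem STree.splitEffect_two (hasc : Ascending (as ++ x :: bs)) (hes : d.entries = as ++ x :: bs)
    (hl : as.length = cl.length) (h₁ : d₁.entries = as) (h₂ : d₂.entries = bs) :
    STree.SplitEffect (n := n + 1) a ⟨addr, d, cl ++ c :: cr⟩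
      (.two ⟨a, d₁, cl ++ [c]⟩ x.key x.val ⟨addr, d₂, cr⟩) where
  addr := rfl
  pairs := by
    simp only [SRes.pairs, STree.entries, h₁, h₂, hes, List.flatMap_append, List.flatMap_cons,
      List.flatMap_nil, pairsOf_append, pairsOf_cons, pairsOf_nil]
    abel
  addrs := by
    simp only [SRes.addrs, STree.addrs, List.flatMap_append, List.flatMap_cons, List.flatMap_nil,
      ← Multiset.cons_coe, ← Multiset.coe_add, ← Multiset.singleton_add, Multiset.coe_nil]
    abel
  path h y hpath := by
    have hlmap : (as.map Entry.key).length = cl.length := by rwa [List.length_map]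
    have hbs := (List.pairwise_cons.1 (ascending_append.1 hasc).2.1).1
    have has : ∀ z ∈ as, z.key < x.key := fun z hz =>
      (ascending_append.1 hasc).2.2 z hz x (by simp)
    refine ⟨fun hy hlt => ?_, fun hy hlt => ?_⟩
    all_goals
      obtain ⟨hall, hsearch⟩ := hpath hlt
      rw [DTree.separators_eq hall hes, List.map_append, List.map_cons] at hsearch
      simp only [hes, List.forall_mem_append, List.forall_mem_cons] at hall
    · rw [searchChild_append_of_le hlmap] at hsearch
      · refine ⟨h₁.symm ▸ hall.1, ?_⟩
        rwa [DTree.separators_eq (h₁.symm ▸ hall.1) h₁]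
      · simpa [hy] using fun z hz => (hy.trans_lt (hbs z hz)).le
    · rw [List.append_cons, List.append_cons cl, searchChild_append_of_lt] at hsearch
      · refine ⟨h₂.symm ▸ hall.2.2, ?_⟩
        rwa [DTree.separators_eq (h₂.symm ▸ hall.2.2) h₂]
      · simpa using hl
      · simpa [or_imp, forall_and, hy] using fun z hz => (has z hz).trans hy

end split

theorem splitNode_spec (hB : 3 ≤ p.B) (hB' : 2 ≤ p.B') (hfs : p.f ≤ p.s)
    (hd : d.LinksTo p last lo (p.f - 1 + 1) (STree.WellFormed p n false) cs)
    (hall : ∀ z ∈ d.entries, z.ptr.isSome) (hlen : p.f - 1 < d.separators.length) :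
    (splitNode p a addr d cs).WellFormed p isRoot ∧
      STree.SplitEffect (n := n + 1) a ⟨addr, d, cs⟩ (splitNode p a addr d cs) := by
  obtain ⟨as, x, bs, cl, c, cr, hes, rfl, hm, hl, hleft, hright⟩ :=
    hd.exists_median hB hB' hall hlen
  have hasc := hes ▸ hd.wellFormed.ascending
  obtain ⟨has, hxbs, -⟩ := ascending_append.1 hasc
  have h₁ := (DTree.wellFormed_build (p := p) hB hB' has x.ptr).2
  have h₂ := (DTree.wellFormed_build (p := p) hB hB' (List.pairwise_cons.1 hxbs).2 last).2
  have hkeys := hd.searchNode.separates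
  rw [DTree.separators_eq hall hes, List.map_append, List.map_cons] at hkeys
  rw [splitNode_eq hd.wellFormed hall hes hm hl]
  simp only [hes, List.forall_mem_append, List.forall_mem_cons] at hall
  exact ⟨⟨.of_linksTo hfs (h₁.symm ▸ hall.1) hleft le_rfl,
    .of_linksTo hfs (h₂.symm ▸ hall.2.2) hright le_rfl,
    STree.entries_le_and_lt_of_split hasc hkeys hl h₁ h₂⟩,
    STree.splitEffect_two hasc hes hl h₁ h₂⟩

theorem STree.insertEffect_self {d' : DTree K V} {fl : List (Entry K V)}
    (hpairs : pairsOf d'.entries + pairsOf fl = pairsOf d.entries + {(e.key, e.val)})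
    (hfl : ∀ x ∈ fl, x.ptr = none ∧ ∀ z ∈ d'.entries, z.ptr.isSome) :
    STree.InsertEffect (n := n + 1) a 0 (n + 1) e ⟨addr, d, cs⟩ (.one ⟨addr, d', cs⟩, fl) where
  addr := rfl
  pairs := by
    simp only [SRes.pairs, STree.entries, pairsOf_append]
    grind
  addrs := AddrsExtend.refl a 0 _
  path h' y hle _ := SRes.onlySKeysAbove_of_le hle
  flushed x hx := ⟨(hfl x hx).1, by omega, _, rfl, fun _ =>
    ⟨(hfl x hx).2, fun c _ => onlySKeysAbove_of_le le_rfl⟩⟩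

theorem STree.insertAt_self (hB : 3 ≤ p.B) (hB' : 2 ≤ p.B') (hfs : p.f ≤ p.s)
    {t : STree K V (n + 1)} (ht : STree.WellFormed p (n + 1) isRoot t) (hptr : e.ptr = none)
    (he : e.key ∉ keySet (STree.entries (n + 1) t)) :
    (STree.insertAt p a (n + 1) e (n + 1) t).1.WellFormed p isRoot ∧
      STree.InsertEffect a 0 (n + 1) e t (STree.insertAt p a (n + 1) e (n + 1) t) := by
  obtain ⟨addr, d, cs⟩ := t
  obtain ⟨-, last, hd⟩ := ht
  rw [STree.entries, keySet_append, Set.mem_union, not_or] at he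
  have hd₁ := hd.insert hB hB' he.1 hptr
  have hpairs := hd.wellFormed.pairsOf_insert hB hB' he.1
  simp only [STree.insertAt, if_true]
  split_ifs with hsize
  · exact ⟨⟨hsize, last, hd₁⟩, STree.insertEffect_self (by simpa using hpairs) (by simp)⟩
  · have hasc : Ascending (sKeys (d.insert p e).entries) :=
      hd₁.wellFormed.ascending.sublist List.filter_sublist
    have hall : ∀ z ∈ sKeys (d.insert p e).entries, z.ptr.isSome := fun z hz => (mem_sKeys.1 hz).2
    have hentries := (DTree.wellFormed_build (p := p) hB hB' hasc last).2
    rw [hd₁.wellFormed.lastPtr_eq]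
    refine ⟨STree.WellFormed.of_linksTo (addr := addr) hfs (hentries.symm ▸ hall)
      (DTree.linksTo_build hB hB' hasc hall hd₁.ptrs hd₁.searchNode) le_rfl,
      STree.insertEffect_self ?_ fun x hx => ⟨?_, hentries.symm ▸ hall⟩⟩
    · rw [hentries, pairsOf_sKeys_add_rKeys, hpairs]
    · simpa using (List.mem_filter.1 hx).2

section child

variable {kl kr : List K} {fl : List (Entry K V)}

theorem STree.InsertEffect.keySet_subset (heff : STree.InsertEffect a m h e c (.one c', fl)) :
    keySet (STree.entries n c') ⊆ insert e.key (keySet (STree.entries n c)) ∧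
      keySet fl ⊆ insert e.key (keySet (STree.entries n c)) :=
  ⟨keySet_subset_insert (heff.pairs ▸ Multiset.le_add_right ..),
    keySet_subset_insert (heff.pairs ▸ Multiset.le_add_left ..)⟩

theorem STree.InsertEffect.keySet_subset_of_two {l r : STree K V n} {k : K} {x : V}
    (heff : STree.InsertEffect a m h e c (.two l k x r, fl)) :
    keySet (STree.entries n l) ⊆ insert e.key (keySet (STree.entries n c)) ∧
      keySet (STree.entries n r) ⊆ insert e.key (keySet (STree.entries n c)) := by
  have hpairs : pairsOf (STree.entries n l) + {(k, x)} + pairsOf (STree.entries n r) + pairsOf fl =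
    pairsOf (STree.entries n c) + {(e.key, e.val)} := heff.pairs
  refine ⟨keySet_subset_insert (hpairs ▸ ?_), keySet_subset_insert (hpairs ▸ ?_)⟩
  · rw [add_assoc, add_assoc]
    exact Multiset.le_add_right ..
  · exact (Multiset.le_add_left ..).trans (Multiset.le_add_right ..)

theorem STree.InsertEffect.flushed_eq_nil {l r : STree K V n} {k : K} {x : V}
    (heff : STree.InsertEffect a m h e c (.two l k x r, fl)) : fl = [] := by
  refine List.eq_nil_iff_forall_not_mem.2 fun z hz => ?_
  obtain ⟨-, -, t', ht', -⟩ := heff.flushed z hz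
  cases ht'

theorem STree.InsertEffect.replace (hd : d.LinksTo p last lo hi Q (cl ++ c :: cr))
    (hsep : d.separators = kl ++ kr) (hpos : IsSearchPos e.key kl kr cl cr)
    (hall : ∀ z ∈ d.entries, z.ptr.isSome)
    (heff : STree.InsertEffect a m h e c (.one c', fl)) :
    STree.InsertEffect (n := n + 1) a m h e ⟨addr, d, cl ++ c :: cr⟩
      (.one ⟨addr, d, cl ++ c' :: cr⟩, fl) where
  addr := rfl
  pairs := by
    have hpairs : pairsOf (STree.entries n c') + pairsOf fl = _ := heff.pairs
    simp only [SRes.pairs, STree.pairsOf_entries_succ, List.flatMap_cons, pairsOf_append]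
    grind
  addrs := by
    have haddrs : AddrsExtend a m (STree.addrs n c) (STree.addrs n c') := heff.addrs
    simp only [SRes.addrs, STree.coe_addrs_succ, List.flatMap_cons, ← Multiset.coe_add]
    convert haddrs.add_right ({addr} + (↑(cl.flatMap fun c => STree.addrs n c) +
      ↑(cr.flatMap fun c => STree.addrs n c))) using 1 <;> abel
  path h' y hle hpath hlt :=
    ⟨(hpath hlt).1, forall_searchChild_replace (hpath hlt).2 (heff.path h' y hle)⟩
  flushed x hx := by
    obtain ⟨hptr, hh, t', ht', hpath⟩ := heff.flushed x hx
    cases ht'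
    refine ⟨hptr, hh, _, rfl, fun _ => ⟨hall, ?_⟩⟩
    have hkeys := hd.searchNode.separates
    rw [hsep] at hkeys ⊢
    have hpos' : IsSearchPos x.key kl kr cl cr := by
      rcases heff.keySet_subset.2 ⟨x, hx, rfl⟩ with hxe | hxc
      · exact hxe ▸ hpos
      · exact hkeys.isSearchPos_of_mem hpos.length_left hpos.length_right hxc
    simpa [hpos'.searchChild_eq] using hpath

theorem STree.InsertEffect.replace_two {d₁ : DTree K V} {l r : STree K V n} {k : K} {x : V}
    (hsep : d.separators = kl ++ kr) (hl : kl.length = cl.length)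
    (hks : d₁.separators.Pairwise (· < ·)) (hsep₁ : d₁.separators = kl ++ k :: kr)
    (hall₁ : ∀ z ∈ d₁.entries, z.ptr.isSome)
    (hpairs₁ : pairsOf d₁.entries = pairsOf d.entries + {(k, x)})
    (heff : STree.InsertEffect a m h e c (.two l k x r, [])) :
    STree.InsertEffect (n := n + 1) a m h e ⟨addr, d, cl ++ c :: cr⟩
      (.one ⟨addr, d₁, cl ++ l :: r :: cr⟩, []) where
  addr := rfl
  pairs := by
    have hpairs : pairsOf (STree.entries n l) + {(k, x)} + pairsOf (STree.entries n r) +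
      pairsOf [] = _ := heff.pairs
    simp only [SRes.pairs, STree.pairsOf_entries_succ, List.flatMap_cons, pairsOf_append,
      pairsOf_nil] at hpairs ⊢
    grind
  addrs := by
    have haddrs : AddrsExtend a m (STree.addrs n c) (↑(STree.addrs n l) + ↑(STree.addrs n r)) :=
      heff.addrs
    simp only [SRes.addrs, STree.coe_addrs_succ, List.flatMap_cons, ← Multiset.coe_add]
    convert haddrs.add_right ({addr} + (↑(cl.flatMap fun c => STree.addrs n c) +
      ↑(cr.flatMap fun c => STree.addrs n c))) using 1 <;> abel
  path h' y hle hpath hlt := by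
    rw [hsep₁] at hks ⊢
    exact ⟨hall₁, forall_searchChild_replace_two hl hks (hsep ▸ (hpath hlt).2)
      (fun hy hc => (heff.path h' y hle hc).1 hy) fun hy hc => (heff.path h' y hle hc).2 hy⟩
  flushed := by simp

end child

end order

section order

variable [LinearOrder K] {p : Params} {n a m h addr : ℕ} {e : Entry K V} {isRoot : Bool}

variable {last : Option ℕ} {lo hi : ℕ} {d : DTree K V}
  {cl cr : List (STree K V n)} {c c' l r : STree K V n} {k : K} {x : V}

section below

variable {kl kr : List K} {fl : List (Entry K V)}

theorem STree.insertAt_eq_of_one (hh : h ≠ n + 1)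
    (hidx : ((cl ++ c :: cr).findIdx fun c => d.route e.key = some (STree.addr n c)) = cl.length)
    (hres : STree.insertAt p a h e n c = (.one c', fl)) :
    STree.insertAt p a h e (n + 1) ⟨addr, d, cl ++ c :: cr⟩ =
      (.one ⟨addr, d, cl ++ c' :: cr⟩, fl) := by
  simp [STree.insertAt, hh, hidx, hres]

theorem STree.insertAt_eq_of_two (hh : h ≠ n + 1)
    (hidx : ((cl ++ c :: cr).findIdx fun c => d.route e.key = some (STree.addr n c)) = cl.length)
    (hres : STree.insertAt p a h e n c = (.two l k x r, fl)) :
    STree.insertAt p a h e (n + 1) ⟨addr, d, cl ++ c :: cr⟩ =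
      let d₁ := d.insertS p ⟨k, x, some (STree.addr n l)⟩ (some (STree.addr n r))
      if d₁.separators.length ≤ p.f - 1 then (.one ⟨addr, d₁, cl ++ l :: r :: cr⟩, fl)
      else (splitNode p (a + (n + 1)) addr d₁ (cl ++ l :: r :: cr), fl) := by
  simp [STree.insertAt, hh, hidx, hres, DTree.length_separators]

theorem STree.insertS_of_two (hB : 3 ≤ p.B) (hB' : 2 ≤ p.B') (hf : 3 ≤ p.f) (hs : 2 ≤ p.s)
    (hd : d.LinksTo p last lo hi (STree.WellFormed p n false) (cl ++ c :: cr))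
    (hsep : d.separators = kl ++ kr) (hpos : IsSearchPos e.key kl kr cl cr)
    (hall : ∀ z ∈ d.entries, z.ptr.isSome) (hwf : (SRes.two l k x r).WellFormed p isRoot)
    (heff : STree.InsertEffect a m h e c (.two l k x r, [])) :
    let d₁ := d.insertS p ⟨k, x, some (STree.addr n l)⟩ (some (STree.addr n r))
    d₁.LinksTo p last lo (hi + 1) (STree.WellFormed p n false) (cl ++ l :: r :: cr) ∧
      (∀ z ∈ d₁.entries, z.ptr.isSome) ∧
      STree.InsertEffect (n := n + 1) a m h e ⟨addr, d, cl ++ c :: cr⟩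
        (.one ⟨addr, d₁, cl ++ l :: r :: cr⟩, []) := by
  obtain ⟨hwfl, hwfr, hlk, hrk⟩ := hwf
  have hnode := (hsep ▸ hd.searchNode).replace_two hpos heff.keySet_subset_of_two.1
    heff.keySet_subset_of_two.2 (forall_mem_keySet.2 hlk) (forall_mem_keySet.2 hrk)
    (keySet_nonempty (hwfl.entries_ne_nil hf hs))
    (keySet_nonempty (hwfr.entries_ne_nil hf hs)) hwfl hwfr
  obtain ⟨hd₁, hsep₁, hpairs₁, hall₁⟩ := hd.insertS (e := ⟨k, x, some (STree.addr n l)⟩)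
    hB hB' hall hsep hpos.length_left rfl heff.addr hnode
  exact ⟨hd₁, hall₁, heff.replace_two hsep hpos.length_left
    hd₁.wellFormed.pairwise_separators hsep₁ hall₁ hpairs₁⟩

theorem STree.insertAt_spec_succ (hB : 3 ≤ p.B) (hB' : 2 ≤ p.B') (hf : 3 ≤ p.f) (hfs : p.f ≤ p.s)
    (hd : d.LinksTo p last (if isRoot then 1 else (p.f - 1) / 2) (p.f - 1)
      (STree.WellFormed p n false) (cl ++ c :: cr))
    (hsize : d.size ≤ p.s) (hsep : d.separators = kl ++ kr)
    (hpos : IsSearchPos e.key kl kr cl cr) (hall : ∀ z ∈ d.entries, z.ptr.isSome)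
    (hh : h ≠ n + 1)
    (hidx : ((cl ++ c :: cr).findIdx fun c => d.route e.key = some (STree.addr n c)) = cl.length)
    (hwf : (STree.insertAt p a h e n c).1.WellFormed p false)
    (heff : STree.InsertEffect a (n + 1) h e c (STree.insertAt p a h e n c)) :
    (STree.insertAt p a h e (n + 1) ⟨addr, d, cl ++ c :: cr⟩).1.WellFormed p isRoot ∧
      STree.InsertEffect (n := n + 1) a (n + 2) h e ⟨addr, d, cl ++ c :: cr⟩
        (STree.insertAt p a h e (n + 1) ⟨addr, d, cl ++ c :: cr⟩) := by
  rcases hres : STree.insertAt p a h e n c with ⟨c' | ⟨l, k, x, r⟩, fl⟩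
  all_goals rw [hres] at hwf heff
  · rw [STree.insertAt_eq_of_one hh hidx hres]
    exact ⟨⟨hsize, last, hd.replace hsep hpos heff.addr heff.keySet_subset.1 hwf⟩,
      (heff.replace hd hsep hpos hall).mono (Nat.le_succ _)⟩
  · obtain rfl := heff.flushed_eq_nil
    obtain ⟨hd₁, hall₁, heff₁⟩ := STree.insertS_of_two (addr := addr) hB hB' hf (by omega) hd hsep
      hpos hall hwf heff
    rw [STree.insertAt_eq_of_two hh hidx hres]
    dsimp only at hd₁ hall₁ heff₁ ⊢
    split_ifs with hlen
    · exact ⟨STree.WellFormed.of_linksTo (addr := addr) hfs hall₁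
        { hd₁ with searchNode := hd₁.searchNode.of_length_le hlen } le_rfl,
        heff₁.mono (Nat.le_succ _)⟩
    · obtain ⟨hwf₂, heff₂⟩ := splitNode_spec (a := a + (n + 1)) (addr := addr) (isRoot := isRoot)
        hB hB' hfs hd₁ hall₁ (not_le.1 hlen)
      exact ⟨hwf₂, heff₁.split heff₂⟩

end below

theorem STree.insertAt_spec (hB : 3 ≤ p.B) (hB' : 2 ≤ p.B') (hf : 3 ≤ p.f) (hfs : p.f ≤ p.s)
    (hptr : e.ptr = none) {t : STree K V n} (ht : STree.WellFormed p n isRoot t)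
    (he : e.key ∉ keySet (STree.entries n t)) (haddrs : (STree.addrs n t).Nodup)
    (hpath : OnlySKeysAbove h e.key n t) (hh : h ≤ n) :
    (STree.insertAt p a h e n t).1.WellFormed p isRoot ∧
      STree.InsertEffect a (n + 1) h e t (STree.insertAt p a h e n t) := by
  induction n generalizing isRoot with
  | zero => exact STree.insertAt_zero hB hB' ht hptr he
  | succ n ih =>
    rcases hh.eq_or_lt with rfl | hlt
    · obtain ⟨hwf, heff⟩ := STree.insertAt_self (a := a) hB hB' hfs ht hptr he
      exact ⟨hwf, heff.mono (Nat.zero_le _)⟩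
    obtain ⟨addr, d, cs⟩ := t
    obtain ⟨hsize, last, hd⟩ := ht
    obtain ⟨hall, hsearch⟩ := hpath hlt
    obtain ⟨kl, kr, cl, c, cr, hsep, rfl, hpos⟩ := exists_isSearchPos
      hd.wellFormed.pairwise_separators hd.searchNode.length_kids e.key
    rw [hsep, hpos.searchChild_eq] at hsearch
    simp only [STree.entries, List.flatMap_append, List.flatMap_cons, keySet_append,
      Set.mem_union, not_or] at he
    obtain ⟨hed, -, hec, -⟩ := he
    have hkids := (List.nodup_cons.1 haddrs).2
    have hidx := hd.findIdx_route hsep hpos hed hkids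
    obtain ⟨hwf, heff⟩ := ih (hd.searchNode.forall_kids c (by simp)) hec
      ((List.nodup_flatMap.1 hkids).1 c (by simp)) (hsearch c rfl) (by omega)
    exact STree.insertAt_spec_succ hB hB' hf hfs hd hsize hsep hpos hall hlt.ne hidx hwf heff

end order

/-! ### Insertion into an NB-tree -/

theorem map_fst_pairsOf (es : List (Entry K V)) :
    (pairsOf es).map Prod.fst = ↑(es.map Entry.key) := by
  simp [pairsOf, Function.comp_def]

theorem NBTree.coe_keys (t : NBTree K V) :
    (t.keys : Multiset K) = (pairsOf t.entries).map Prod.fst :=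
  (map_fst_pairsOf _).symm

section order

variable [LinearOrder K] {p : Params} {n h : ℕ}

/-- The NB-tree that results from the outcome of an insertion below the root s-node.  Two s-nodes
get a new parent with address `b`. -/
def SRes.toNBTree (p : Params) (b : ℕ) : SRes K V n → NBTree K V
  | .one t => ⟨n, t⟩
  | .two l k x r => ⟨n + 1, ⟨b, (DTree.empty none).insertS p ⟨k, x, some (STree.addr n l)⟩
      (some (STree.addr n r)), [l, r]⟩⟩

theorem NBTree.insertAt_eq {e : Entry K V} {t : NBTree K V} {a : ℕ}
    (ha : a = (STree.addrs t.height t.root).foldr max 0 + 1) :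
    t.insertAt p h e = ((STree.insertAt p a h e t.height t.root).1.toNBTree p (a + t.height + 1),
      (STree.insertAt p a h e t.height t.root).2) := by
  rw [NBTree.insertAt, ← ha]
  rcases STree.insertAt p a h e t.height t.root with ⟨_ | _, _⟩ <;> rfl

theorem DTree.insertS_empty (hB : 3 ≤ p.B) (hB' : 2 ≤ p.B') {e : Entry K V} (he : e.ptr.isSome)
    (q : Option ℕ) :
    ((DTree.empty none).insertS p e q).WellFormed p q ∧
      ((DTree.empty none).insertS p e q).entries = [e] ∧
      (∀ z ∈ ((DTree.empty none).insertS p e q).entries, z.ptr.isSome) ∧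
      ((DTree.empty none).insertS p e q).separators = [e.key] := by
  obtain ⟨hwf, hentries⟩ : ((DTree.empty none).insertS p e q).WellFormed p q ∧
      ((DTree.empty none).insertS p e q).entries = [e] :=
    (DTree.wellFormed_empty p none).insertS (as := []) (bs := []) (last' := q) hB hB'
      (by simp) (by simp) (by simp) he (.inr (by simp))
  have hall : ∀ z ∈ ((DTree.empty none).insertS p e q).entries, z.ptr.isSome := by
    rw [hentries]
    simpa using he
  exact ⟨hwf, hentries, hall, DTree.separators_eq hall hentries⟩

section toNBTree

variable {res : SRes K V n} {b : ℕ}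

theorem SRes.le_height_toNBTree : n ≤ (res.toNBTree p b).height := by
  cases res
  · exact le_rfl
  · exact Nat.le_succ n

theorem SRes.WellFormed.toNBTree (hB : 3 ≤ p.B) (hB' : 2 ≤ p.B') (hf : 2 ≤ p.f) (hfs : p.f ≤ p.s)
    (hres : res.WellFormed p true) :
    STree.WellFormed p (res.toNBTree p b).height true (res.toNBTree p b).root := by
  cases res with
  | one t => exact hres
  | two l k x r =>
    obtain ⟨hl, hr, hlk, hrk⟩ := hres
    obtain ⟨hd, hentries, hall, hsep⟩ := DTree.insertS_empty
      (e := ⟨k, x, some (STree.addr n l)⟩) hB hB' rfl (some (STree.addr n r))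
    refine STree.WellFormed.of_linksTo (addr := b) (lo := 1) hfs hall ⟨hd, ?_, ?_⟩ le_rfl
    · rw [sKeys_eq_self hall, hentries]
      rfl
    · rw [hsep]
      exact
        { le_length := le_rfl
          length_le := show 1 ≤ p.f - 1 by omega
          length_kids := rfl
          separates := ⟨forall_mem_keySet.2 hlk, by simp,
            List.forall_mem_singleton.2 (forall_mem_keySet.2 hrk), trivial⟩
          forall_kids := by simp [hl, hr] }

theorem SRes.pairsOf_entries_toNBTree (hB : 3 ≤ p.B) (hB' : 2 ≤ p.B') :
    pairsOf (res.toNBTree p b).entries = res.pairs := by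
  cases res with
  | one t => rfl
  | two l k x r =>
    have hentries := (DTree.insertS_empty (e := ⟨k, x, some (STree.addr n l)⟩) hB hB' rfl
      (some (STree.addr n r))).2.1
    simp only [SRes.toNBTree, NBTree.entries, STree.entries, hentries, SRes.pairs, pairsOf_append,
      pairsOf_cons, pairsOf_nil, List.flatMap_cons, List.flatMap_nil]
    abel

theorem SRes.nodup_addrs_toNBTree (hnodup : res.addrs.Nodup) (hb : b ∉ res.addrs) :
    (STree.addrs (res.toNBTree p b).height (res.toNBTree p b).root).Nodup := by
  cases res with
  | one t => exact hnodup
  | two l k x r =>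
    simpa [SRes.toNBTree, STree.addrs] using ⟨by simpa [SRes.addrs] using hb, hnodup⟩

theorem SRes.OnlySKeysAbove.toNBTree (hB : 3 ≤ p.B) (hB' : 2 ≤ p.B') {y : K}
    (hpath : res.OnlySKeysAbove h y) :
    NBT.OnlySKeysAbove h y (res.toNBTree p b).height (res.toNBTree p b).root := by
  cases res with
  | one t => exact hpath
  | two l k x r =>
    obtain ⟨-, -, hall, hsep⟩ := DTree.insertS_empty
      (e := ⟨k, x, some (STree.addr n l)⟩) hB hB' rfl (some (STree.addr n r))
    refine fun _ => ⟨hall, ?_⟩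
    rw [hsep]
    rcases le_or_gt y k with hy | hy
    · simpa [searchChild, hy.not_gt] using hpath.1 hy
    · simpa [searchChild, hy] using hpath.2 hy

end toNBTree

/-- The invariant of NB-trees under insertion.  It admits the initial NB-tree, whose root s-node is
too small for the size requirements. -/
structure NBTree.WellFormed (p : Params) (t : NBTree K V) : Prop where
  root : STree.WellFormed p t.height true t.root
  keys : t.keys.Nodup
  addrs : (STree.addrs t.height t.root).Nodup

theorem NBTree.wellFormed_initial (p : Params) (a : ℕ) :
    (NBTree.initial a : NBTree K V).WellFormed p where
  root := ⟨DTree.wellFormed_empty p none, by simp, by simp [DTree.size], by simp [DTree.size]⟩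
  keys := by simp [NBTree.initial, NBTree.keys, NBTree.entries, STree.entries]
  addrs := List.nodup_singleton a

theorem NBTree.WellFormed.of_requirements {t : NBTree K V} (hsize : t.SizeRequirements p)
    (hstruct : t.StructuralRequirements p) (hprop : t.Properties) : t.WellFormed p where
  root := .of_requirements hsize hstruct.2 hprop.1 hprop.2.2.2
  keys := hprop.2.1
  addrs := hprop.2.2.1

theorem NBTree.WellFormed.requirements (hf : 3 ≤ p.f) (hfs : 2 * p.f ≤ p.s) {t : NBTree K V}
    (ht : t.WellFormed p) (hne : t.entries ≠ []) :
    t.SizeRequirements p ∧ t.StructuralRequirements p ∧ t.Properties := by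
  obtain ⟨hsize, hstruct, hbp, hlink⟩ := ht.root.requirements hf (by omega) hne
  exact ⟨hsize, ⟨hfs, hstruct⟩, hbp, ht.keys, ht.addrs, hlink⟩

/-- The entry `e` can be inserted as an r-key at height `h`: it is new, and the s-nodes above height
`h` on its search path contain only s-keys, so that they have room for further s-keys. -/
structure NBTree.CanInsert (h : ℕ) (e : Entry K V) (t : NBTree K V) : Prop where
  height_le : h ≤ t.height
  ptr : e.ptr = none
  key_notMem : e.key ∉ t.keys
  path : OnlySKeysAbove h e.key t.height t.root

/-- The outcome `r` of an insertion of the entries `es` into the NB-tree `t` at height `h`: the new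
NB-tree, and the r-keys that a merge returns for insertion at height `h - 1`. -/
structure NBTree.InsertEffect (p : Params) (h : ℕ) (es : List (Entry K V)) (t : NBTree K V)
    (r : NBTree K V × List (Entry K V)) : Prop where
  wellFormed : r.1.WellFormed p
  height_le : t.height ≤ r.1.height
  pairs : pairsOf r.1.entries + pairsOf r.2 = pairsOf t.entries + pairsOf es
  path : ∀ h' y, h ≤ h' → OnlySKeysAbove h' y t.height t.root →
    OnlySKeysAbove h' y r.1.height r.1.root
  flushed_nodup : (r.2.map Entry.key).Nodup
  flushed : ∀ x ∈ r.2, 1 ≤ h ∧ NBTree.CanInsert (h - 1) x r.1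

variable {t t₁ t₂ : NBTree K V} {e e' : Entry K V} {as bs es fl : List (Entry K V)}

theorem NBTree.InsertEffect.trans {h' : ℕ} (h₁ : NBTree.InsertEffect p h as t (t₁, fl))
    (h₂ : NBTree.InsertEffect p h' (fl ++ bs) t₁ (t₂, [])) (hh : h' ≤ h) :
    NBTree.InsertEffect p h (as ++ bs) t (t₂, []) where
  wellFormed := h₂.wellFormed
  height_le := h₁.height_le.trans h₂.height_le
  pairs := by
    have hp₁ := h₁.pairs
    have hp₂ := h₂.pairs
    simp only [pairsOf_append] at hp₁ hp₂ ⊢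
    grind
  path h'' y hle hpath := h₂.path h'' y (hh.trans hle) (h₁.path h'' y hle hpath)
  flushed_nodup := List.nodup_nil
  flushed := by simp

theorem NBTree.InsertEffect.canInsert (heff : NBTree.InsertEffect p h [e] t (t₁, []))
    (he' : t.CanInsert h e') (hne : e'.key ≠ e.key) : t₁.CanInsert h e' where
  height_le := he'.height_le.trans heff.height_le
  ptr := he'.ptr
  key_notMem := by
    have hpairs : pairsOf t₁.entries = pairsOf t.entries + {(e.key, e.val)} := by
      simpa using heff.pairs
    rw [← Multiset.mem_coe, NBTree.coe_keys, hpairs, Multiset.map_add, ← NBTree.coe_keys]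
    simpa [hne] using he'.key_notMem
  path := heff.path h e'.key le_rfl he'.path

theorem NBTree.InsertEffect.foldl {f : NBTree K V → Entry K V → NBTree K V}
    (hf : ∀ t e, t.WellFormed p → t.CanInsert h e → NBTree.InsertEffect p h [e] t (f t e, []))
    (ht : t.WellFormed p) (hnodup : (es.map Entry.key).Nodup) (hes : ∀ e ∈ es, t.CanInsert h e) :
    NBTree.InsertEffect p h es t (es.foldl f t, []) := by
  induction es generalizing t with
  | nil => exact ⟨ht, le_rfl, rfl, fun _ _ _ hpath => hpath, List.nodup_nil, by simp⟩
  | cons e es ih =>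
    rw [List.map_cons, List.nodup_cons] at hnodup
    rw [List.forall_mem_cons] at hes
    have heff := hf t e ht hes.1
    refine heff.trans (bs := es) (ih heff.wellFormed hnodup.2 fun e' he' => ?_) le_rfl
    exact heff.canInsert (hes.2 e' he') fun heq => hnodup.1 (heq ▸ List.mem_map_of_mem he')

theorem NBTree.insertAt_spec (hB : 3 ≤ p.B) (hB' : 2 ≤ p.B') (hf : 3 ≤ p.f) (hfs : p.f ≤ p.s)
    (ht : t.WellFormed p) (he : t.CanInsert h e) :
    NBTree.InsertEffect p h [e] t (t.insertAt p h e) := by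
  obtain ⟨a, ha⟩ : ∃ a, a = (STree.addrs t.height t.root).foldr max 0 + 1 := ⟨_, rfl⟩
  have hlt : ∀ x ∈ (STree.addrs t.height t.root : Multiset ℕ), x < a := fun x hx =>
    ha ▸ Nat.lt_succ_of_le (List.le_max_of_le' 0 (Multiset.mem_coe.1 hx) le_rfl)
  obtain ⟨hwf, heff⟩ := STree.insertAt_spec (a := a) hB hB' hf hfs he.ptr ht.root
    (fun hmem => he.key_notMem (List.mem_map.2 hmem)) ht.addrs he.path he.height_le
  rw [NBTree.insertAt_eq ha]
  generalize STree.insertAt p a h e t.height t.root = r at hwf heff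
  set t' := r.1.toNBTree p (a + t.height + 1)
  have hpairs : pairsOf t'.entries + pairsOf r.2 = pairsOf t.entries + pairsOf [e] := by
    rw [SRes.pairsOf_entries_toNBTree hB hB']
    exact heff.pairs
  have hkeys : (↑t'.keys + ↑(r.2.map Entry.key) : Multiset K).Nodup := by
    rw [NBTree.coe_keys, ← map_fst_pairsOf, ← Multiset.map_add, hpairs, Multiset.map_add,
      ← NBTree.coe_keys, map_fst_pairsOf, add_comm]
    exact List.nodup_cons.2 ⟨he.key_notMem, ht.keys⟩
  obtain ⟨hkeys', hflkeys, hdisj⟩ := Multiset.nodup_add.1 hkeys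
  exact
    { wellFormed := ⟨hwf.toNBTree hB hB' (by omega) hfs, hkeys', SRes.nodup_addrs_toNBTree
        (heff.addrs.nodup ht.addrs hlt) fun hmem =>
          absurd (heff.addrs.lt hlt _ hmem) (lt_irrefl _)⟩
      height_le := SRes.le_height_toNBTree
      pairs := hpairs
      path := fun h' y hle hpath => (heff.path h' y hle hpath).toNBTree hB hB'
      flushed_nodup := hflkeys
      flushed := fun x hx => by
        obtain ⟨hptr, hh, t₁, ht₁, hpath⟩ := heff.flushed x hx
        refine ⟨hh, (Nat.sub_le h 1).trans (he.height_le.trans SRes.le_height_toNBTree), hptr,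
          fun hmem => Multiset.disjoint_left.1 hdisj hmem (List.mem_map_of_mem hx), ?_⟩
        exact SRes.OnlySKeysAbove.toNBTree hB hB' (ht₁ ▸ hpath) }

theorem NBTree.insertRec_spec (hB : 3 ≤ p.B) (hB' : 2 ≤ p.B') (hf : 3 ≤ p.f) (hfs : p.f ≤ p.s)
    (ht : t.WellFormed p) (he : t.CanInsert h e) :
    NBTree.InsertEffect p h [e] t (NBTree.insertRec p h e t, []) := by
  induction h generalizing t e with
  | zero =>
    have heff := NBTree.insertAt_spec hB hB' hf hfs ht he
    have hnil : (t.insertAt p 0 e).2 = [] := List.eq_nil_iff_forall_not_mem.2 fun x hx =>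
      absurd (heff.flushed x hx).1 (by omega)
    rw [NBTree.insertRec]
    exact (Prod.ext rfl hnil : t.insertAt p 0 e = (_, [])) ▸ heff
  | succ h ih =>
    have heff := NBTree.insertAt_spec hB hB' hf hfs ht he
    refine NBTree.InsertEffect.trans (bs := []) heff ?_ (Nat.le_succ h)
    rw [List.append_nil]
    exact NBTree.InsertEffect.foldl (fun t e => ih) heff.wellFormed heff.flushed_nodup
      fun x hx => (heff.flushed x hx).2

theorem NBTree.insert_spec (hB : 3 ≤ p.B) (hB' : 2 ≤ p.B') (hf : 3 ≤ p.f) (hfs : p.f ≤ p.s)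
    (ht : t.WellFormed p) {k : K} (hk : k ∉ t.keys) (x : V) :
    (t.insert p k x).WellFormed p ∧ (t.insert p k x).pairs.Perm ((k, x) :: t.pairs) := by
  have heff := NBTree.insertRec_spec hB hB' hf hfs ht (e := ⟨k, x, none⟩)
    ⟨le_rfl, rfl, hk, onlySKeysAbove_of_le le_rfl⟩
  have hpairs : pairsOf (t.insert p k x).entries = (k, x) ::ₘ pairsOf t.entries := by
    rw [← Multiset.singleton_add, add_comm]
    simpa [NBTree.insert] using heff.pairs
  exact ⟨heff.wellFormed, Multiset.coe_eq_coe.1 hpairs⟩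

end order

end NBT

theorem mainTheorem1 {K : Type*} {V : Type*} [LinearOrder K] (p : NBT.Params)
    (hB : 3 ≤ p.B) (hB' : 3 ≤ p.B') (hf : 3 ≤ p.f) (hfs : 2 * p.f ≤ p.s)
    (t : NBT.NBTree K V)
    (ht : (∃ a : ℕ, t = NBT.NBTree.initial a) ∨
      (t.SizeRequirements p ∧ t.StructuralRequirements p ∧ t.Properties))
    (k : K) (x : V) (hk : k ∉ t.keys) :
    (t.insert p k x).SizeRequirements p ∧
    (t.insert p k x).StructuralRequirements p ∧
    (t.insert p k x).Properties ∧
    ((t.insert p k x).pairs).Perm ((k, x) :: t.pairs) := by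
  have hwf : t.WellFormed p := by
    rcases ht with ⟨a, rfl⟩ | ⟨hsize, hstruct, hprop⟩
    · exact NBT.NBTree.wellFormed_initial p a
    · exact .of_requirements hsize hstruct hprop
  obtain ⟨hwf', hperm⟩ := NBT.NBTree.insert_spec hB (by omega) hf (by omega) hwf hk x
  have hne : (t.insert p k x).entries ≠ [] := List.map_eq_nil_iff.not.1 <|
    List.ne_nil_of_mem (hperm.mem_iff.2 List.mem_cons_self)
  obtain ⟨hsize, hstruct, hprop⟩ := hwf'.requirements hf hfs hne
  exact ⟨hsize, hstruct, hprop, hperm⟩
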